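/- Let $v$ be an indeterminate, $[s]=\frac{v^s-v^{-s}}{v-v^{-1}}$ and $[3]!=[3][2][1]$ in $\mathbb{C}(v)$. Let $\mathsf{p}_{m,n}\in\mathbb{Z}[X,Y]$ ($m,n\ge 0$) be Koornwinder's polynomials, determined by $\mathsf{p}_{0,0}=1$, $X\mathsf{p}_{m,n}=\mathsf{p}_{m+1,n}+\mathsf{p}_{m-1,n+1}+\mathsf{p}_{m,n-1}$ and $Y\mathsf{p}_{m,n}=\mathsf{p}_{m,n+1}+\mathsf{p}_{m+1,n-1}+\mathsf{p}_{m-1,n}$ (terms with a negative index are zero); write $\mathsf{p}_{m,n}=\sum_{k,l}d^{k,l}_{m,n}X^kY^l$. For $e\in\mathbb{Z}_{\ge 0}$ put $t_e=\frac{(e+1)(e+2)}{2}$ and let $V_e\subset\mathbb{C}^2$ be the set of common zeros of all $\mathsf{p}_{m,n}$ with $m+n=e+1$. Let $\zeta=\exp(2\pi i/3)$; the group $\mathbb{Z}/3\mathbb{Z}$ acts on $V_e$ by $(\alpha,\beta)\mapsto(\zeta\alpha,\zeta^{-1}\beta)$. Let $\rho$ be the cyclic permutation $g\mapsto o\mapsto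 p\mapsto g$ of the set of colors $\{g,o,p\}$. Let $T_\infty$ be the associative unital $\mathbb{C}(v)$-algebra generated by $\theta_g,\theta_o,\theta_p$ with relations $\theta_u^2=[3]!\,\theta_u$ and $\theta_u\theta_{\rho(u)}\theta_u=\theta_u\theta_{\rho^{-1}(u)}\theta_u$ for all colors $u$. For a color $u$ and $k,l\ge 0$ let $h^{k,l}_u=\theta_{u_{k+l}}\cdots\theta_{u_1}\theta_{u_0}$, where $u_0=u$, and $u_{i+1}=\rho(u_i)$ for $k$ values of $i$ and $u_{i+1}=\rho^{-1}(u_i)$ for the other $l$ values (the product does not depend on the order). Let $c^{m,n}_u=\sum_{k,l}[2]^{-k-l}d^{k,l}_{m,n}h^{k,l}_u$, and let $T_e$, the trihedral Hecke algebra of level $e$, be the quotient of $T_\infty$ by the two-sided ideal generated by all $c^{m,n}_u$ with $m+n=e+1$ and $u\in\{g,o,p\}$. For $\lambda=(\lambda_g,\lambda_o,\lambda_p)\in\mathbb{C}(v)^3$ denote by $M_{\lambda}$ the one-dimensional representation $\theta_u\mapsto\lambda_u$, and for $z\in\mathbb{C}$ denote by $M_z$ the representation on $\mathbb{C}(v)^3$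 with $$\theta_g\mapsto[2]\begin{pmatrix}[3]&\overline{z}&z\\0&0&0\\0&0&0\end{pmatrix},\quad \theta_o\mapsto[2]\begin{pmatrix}0&0&0\\z&[3]&\overline{z}\\0&0&0\end{pmatrix},\quad \theta_p\mapsto[2]\begin{pmatrix}0&0&0\\0&0&0\\\overline{z}&z&[3]\end{pmatrix}$$ (whenever these assignments define representations of $T_e$). **Theorem.** Let $e\ge 0$. The algebra $T_e$ is semisimple. Every point of $V_e$ has the form $(z,\overline{z})$, and $(0,0)\in V_e$ if and only if $e\equiv 0\bmod 3$. The following representations of $T_e$ are well defined and simple, and every simple $T_e$-module is isomorphic to one of them: 1. the one-dimensional representations $M_{0,0,0}$, $M_{[3]!,0,0}$, $M_{0,[3]!,0}$, $M_{0,0,[3]!}$ if $e\equiv 0\bmod 3$, and only $M_{0,0,0}$ if $e\not\equiv 0\bmod 3$ (so there are four, respectively one, of them); 2. the three-dimensional representations $M_z$ with $z\ne 0$ and $(z,\overline{z})\in V_e$. The representations in (1) are pairwise non-isomorphic, none of them is isomorphic to one in (2), and $M_z\cong M_{z'}$ for $M_z,M_{z'}$ in (2) if and only if $(z,\overline{z})$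 and $(z',\overline{z'})$ lie in the same $\mathbb{Z}/3\mathbb{Z}$-orbit. The number of $\mathbb{Z}/3\mathbb{Z}$-orbits of nonzero points of $V_e$, and hence of isomorphism classes in (2), is $\frac{t_e-1}{3}$ if $e\equiv 0\bmod 3$ and $\frac{t_e}{3}$ otherwise. -/

import Mathlib

namespace Trihedral

/-- The ground field `ℂ(v)`. -/
abbrev K : Type := RatFunc ℂ

/-- The generic parameter `v`. -/
noncomputable def v : K := RatFunc.X

/-- The quantum number `[s] = (v ^ s - v ^ (-s)) / (v - v⁻¹)`. -/
noncomputable def qNum (s : ℤ) : K := (v ^ s - v ^ (-s)) / (v - v⁻¹)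

/-- The quantum factorial `[t]! = [t] [t-1] ⋯ [1]`. -/
noncomputable def qFact (t : ℕ) : K := ∏ i ∈ Finset.range t, qNum (i + 1)

/-! ### Koornwinder's polynomials -/

/-- Koornwinder's polynomials `p_{m,n} ∈ ℤ[X, Y]` (`X` is the variable `0` and `Y` the variable `1`):
`p_{0,0} = 1`, `X p_{m,n} = p_{m+1,n} + p_{m-1,n+1} + p_{m,n-1}` and
`Y p_{m,n} = p_{m,n+1} + p_{m+1,n-1} + p_{m-1,n}`, where terms with a negative index are zero (the
first recursion, and the second one for `m = 0`, already determine all of them). They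
express the class of the simple `𝔰𝔩₃`-module of highest weight `(m, n)` through the classes `X`, `Y`
of the two fundamental modules, see `koornwinder_weyl_character`. -/
noncomputable def koornwinder : ℕ → ℕ → MvPolynomial (Fin 2) ℤ
  | 0, 0 => 1
  | 0, 1 => MvPolynomial.X 1
  | 0, n + 2 => MvPolynomial.X 1 * koornwinder 0 (n + 1) - koornwinder 1 n
  | 1, 0 => MvPolynomial.X 0
  | 1, n + 1 => MvPolynomial.X 0 * koornwinder 0 (n + 1) - koornwinder 0 n
  | m + 2, 0 => MvPolynomial.X 0 * koornwinder (m + 1) 0 - koornwinder m 1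
  | m + 2, n + 1 =>
      MvPolynomial.X 0 * koornwinder (m + 1) (n + 1) - koornwinder m (n + 2) - koornwinder (m + 1) n
termination_by m n => m + n

/-- The Weyl character formula for `SL₃`: at the two fundamental characters of the
torus element `diag(x, y, z)`, the polynomial `p_{m,n}` is the character of the simple module of
highest weight `(m, n)`, the quotient of the alternants for `(m+n+2, n+1, 0)` and `(2, 1, 0)`. -/
theorem koornwinder_weyl_character {R : Type*} [CommRing R] (x y z : R) (h : x * y * z = 1)
    (m n : ℕ) :
    MvPolynomial.aeval ![x + y + z, x * y + x * z + y * z] (koornwinder m n)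
        * (!![x ^ 2, x, 1; y ^ 2, y, 1; z ^ 2, z, 1] : Matrix (Fin 3) (Fin 3) R).det
      = (!![x ^ (m + n + 2), x ^ (n + 1), 1; y ^ (m + n + 2), y ^ (n + 1), 1;
            z ^ (m + n + 2), z ^ (n + 1), 1] : Matrix (Fin 3) (Fin 3) R).det := by
  induction m, n using koornwinder.induct with
  | case1 => simp [koornwinder, Matrix.det_fin_three]
  | case2 =>
    simp only [koornwinder, Matrix.det_fin_three]
    simp
    ring
  | case3 n h1 h2 =>
    rw [koornwinder]
    simp only [map_sub, map_mul, MvPolynomial.aeval_X, sub_mul, mul_assoc, h1, h2]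
    simp [Matrix.det_fin_three]
    linear_combination (x ^ (n + 3) * y ^ (n + 1) - x ^ (n + 3) * z ^ (n + 1) - x ^ (n + 1) * y ^ (n + 3)
      + x ^ (n + 1) * z ^ (n + 3) + y ^ (n + 3) * z ^ (n + 1) - y ^ (n + 1) * z ^ (n + 3)) * h
  | case4 =>
    simp only [koornwinder, Matrix.det_fin_three]
    simp
    ring
  | case5 n h1 h2 =>
    rw [koornwinder]
    simp only [map_sub, map_mul, MvPolynomial.aeval_X, sub_mul, mul_assoc, h1, h2]
    simp [Matrix.det_fin_three]
    linear_combination (x ^ (n + 2) * y ^ (n + 1) - x ^ (n + 2) * z ^ (n + 1) - x ^ (n + 1) * y ^ (n + 2)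
      + x ^ (n + 1) * z ^ (n + 2) + y ^ (n + 2) * z ^ (n + 1) - y ^ (n + 1) * z ^ (n + 2)) * h
  | case6 m h1 h2 =>
    rw [koornwinder]
    simp only [map_sub, map_mul, MvPolynomial.aeval_X, sub_mul, mul_assoc, h1, h2]
    simp [Matrix.det_fin_three]
    ring
  | case7 m n h1 h2 h3 =>
    rw [koornwinder]
    simp only [map_sub, map_mul, MvPolynomial.aeval_X, sub_mul, mul_assoc, h1, h2, h3]
    simp [Matrix.det_fin_three]
    linear_combination (x ^ (m + n + 3) * y ^ (n + 1) - x ^ (m + n + 3) * z ^ (n + 1) - x ^ (n + 1) * y ^ (m + n + 3)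
      + x ^ (n + 1) * z ^ (m + n + 3) + y ^ (m + n + 3) * z ^ (n + 1) - y ^ (n + 1) * z ^ (m + n + 3)) * h

/-- The triangular number `t_e = (e + 1) (e + 2) / 2`. -/
def triangular (e : ℕ) : ℕ := (e + 1) * (e + 2) / 2

/-- The set `V_e ⊆ ℂ²` of common zeros of the polynomials `p_{m,n}` with `m + n = e + 1`. -/
def vanishingSet (e : ℕ) : Set (ℂ × ℂ) :=
  {p | ∀ m n : ℕ, m + n = e + 1 → MvPolynomial.aeval ![p.1, p.2] (koornwinder m n) = 0}

/-- The third root of unity `ζ = exp (2 π i / 3)`. -/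
noncomputable def ζ : ℂ := Complex.exp (2 * Real.pi * Complex.I / 3)

/-- The orbit of a point of `ℂ²` under the action `(α, β) ↦ (ζ α, ζ⁻¹ β)` of `ℤ/3ℤ`. -/
def orbit (p : ℂ × ℂ) : Set (ℂ × ℂ) :=
  {q | ∃ k : ℕ, q = (ζ ^ k * p.1, (ζ⁻¹) ^ k * p.2)}

/-- The set of `ℤ/3ℤ`-orbits of nonzero points of `V_e`. -/
def nonzeroOrbits (e : ℕ) : Set (Set (ℂ × ℂ)) :=
  orbit '' (vanishingSet e \ {(0, 0)})

/-! ### The trihedral Hecke algebras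

The three secondary colors green, orange, purple are `0, 1, 2 : Fin 3`, with arithmetic modulo `3`.
The cyclic rotation `ρ` (green to orange to purple to green) is `u ↦ u + 1`. -/

/-- The defining relations of the trihedral Hecke algebra of level `∞`: `θ_u² = [3]! θ_u`, and
`θ_u θ_{ρ(u)} θ_u = θ_u θ_{ρ⁻¹(u)} θ_u`, for each color `u`. -/
inductive RelInf : FreeAlgebra K (Fin 3) → FreeAlgebra K (Fin 3) → Prop
  | quadratic (u : Fin 3) :
      RelInf (FreeAlgebra.ι K u * FreeAlgebra.ι K u) (qFact 3 • FreeAlgebra.ι K u)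
  | cubic (u : Fin 3) :
      RelInf (FreeAlgebra.ι K u * FreeAlgebra.ι K (u + 1) * FreeAlgebra.ι K u)
        (FreeAlgebra.ι K u * FreeAlgebra.ι K (u - 1) * FreeAlgebra.ι K u)

/-- The trihedral Hecke algebra `T_∞` of level `∞`. -/
abbrev HeckeInf : Type := RingQuot RelInf

/-- The generators `θ_u` of `T_∞`. -/
noncomputable def θInf (u : Fin 3) : HeckeInf :=
  RingQuot.mkAlgHom K RelInf (FreeAlgebra.ι K u)

/-- The product `h^{k,l}_u = θ_{u_{k+l}} ⋯ θ_{u_1} θ_{u_0}`, where `u_0 = u` and `u_{i+1}` is `ρ(u_i)`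
for `k` values of `i` and `ρ⁻¹(u_i)` for the other `l` values. Here the `k` rotations by `ρ` come
first; the order does not matter, see `h_succ_left`. The color `u + k • 1` is `ρ^k(u)`. -/
noncomputable def h (u : Fin 3) : ℕ → ℕ → HeckeInf
  | 0, 0 => θInf u
  | k + 1, 0 => θInf (u + (k + 1) • (1 : Fin 3)) * h u k 0
  | k, l + 1 => θInf (u + k • (1 : Fin 3) - (l + 1) • (1 : Fin 3)) * h u k l

theorem θInf_cubic (u : Fin 3) :
    θInf u * θInf (u + 1) * θInf u = θInf u * θInf (u - 1) * θInf u := by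
  simpa [θInf] using RingQuot.mkAlgHom_rel K (RelInf.cubic u)

theorem h_leftmost (u : Fin 3) (k l : ℕ) :
    ∃ w, h u k l = θInf (u + k • (1 : Fin 3) - l • (1 : Fin 3)) * w := by
  rcases l with _ | l
  · rcases k with _ | k
    · exact ⟨1, by simp [h]⟩
    · exact ⟨h u k 0, by simp [h]⟩
  · exact ⟨h u k l, by rw [h]⟩

/-- Appending a rotation by `ρ` on the left of `h^{k,l}_u` gives `h^{k+1,l}_u`; by definition,
appending a rotation by `ρ⁻¹` gives `h^{k,l+1}_u`. -/
theorem h_succ_left (u : Fin 3) (k l : ℕ) :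
    θInf (u + (k + 1) • (1 : Fin 3) - l • (1 : Fin 3)) * h u k l = h u (k + 1) l := by
  induction l with
  | zero => rw [h]; simp
  | succ l ih =>
    rw [h, h, ← ih]
    obtain ⟨w, hw⟩ := h_leftmost u k l
    rw [hw]
    have key := θInf_cubic (u + k • (1 : Fin 3) - l • (1 : Fin 3))
    have e1 : u + (k + 1) • (1 : Fin 3) - (l + 1) • (1 : Fin 3) = u + k • (1 : Fin 3) - l • (1 : Fin 3) := by
      simp only [succ_nsmul]; abel
    have e2 : u + k • (1 : Fin 3) - (l + 1) • (1 : Fin 3) = u + k • (1 : Fin 3) - l • (1 : Fin 3) - 1 := by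
      simp only [succ_nsmul]; abel
    have e3 : u + (k + 1) • (1 : Fin 3) - l • (1 : Fin 3) = u + k • (1 : Fin 3) - l • (1 : Fin 3) + 1 := by
      simp only [succ_nsmul]; abel
    rw [e1, e2, e3, ← mul_assoc, ← mul_assoc, ← mul_assoc, ← mul_assoc, key]

/-- The colored Kazhdan-Lusztig element `c^{m,n}_u = ∑_{k,l} [2]^{-k-l} d^{k,l}_{m,n} h^{k,l}_u`, where
`d^{k,l}_{m,n}` is the coefficient of `X^k Y^l` in `p_{m,n}`. -/
noncomputable def c (u : Fin 3) (m n : ℕ) : HeckeInf :=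
  ∑ s ∈ (koornwinder m n).support,
    ((qNum 2)⁻¹ ^ (s 0 + s 1) * ((MvPolynomial.coeff s (koornwinder m n) : ℤ) : K)) • h u (s 0) (s 1)

/-- The generators of the two-sided ideal of `T_∞` that defines `T_e`, as relations. -/
inductive RelLevel (e : ℕ) : HeckeInf → HeckeInf → Prop
  | vanish (u : Fin 3) (m n : ℕ) (hmn : m + n = e + 1) : RelLevel e (c u m n) 0

/-- The trihedral Hecke algebra `T_e` of level `e`: the quotient of `T_∞` by the two-sided ideal
generated by the `c^{m,n}_u` with `m + n = e + 1`. -/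
abbrev Hecke (e : ℕ) : Type := RingQuot (RelLevel e)

/-- The generators `θ_u` of `T_e`. -/
noncomputable def θ (e : ℕ) (u : Fin 3) : Hecke e :=
  RingQuot.mkAlgHom K (RelLevel e) (θInf u)

/-! ### Representations -/

/-- The module over a `ℂ(v)`-algebra `A` that belongs to a representation `φ` of `A` on `V`. -/
@[nolint unusedArguments]
def RepModule {A V : Type} [Semiring A] [Algebra K A] [AddCommGroup V] [Module K V]
    (_φ : A →ₐ[K] Module.End K V) : Type := V

noncomputable instance {A V : Type} [Semiring A] [Algebra K A] [AddCommGroup V] [Module K V]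
    (φ : A →ₐ[K] Module.End K V) : AddCommGroup (RepModule φ) :=
  inferInstanceAs (AddCommGroup V)

/-- An element `a` of `A` acts on `V` as the endomorphism `φ a`. -/
noncomputable instance {A V : Type} [Semiring A] [Algebra K A] [AddCommGroup V] [Module K V]
    (φ : A →ₐ[K] Module.End K V) : Module A (RepModule φ) :=
  Module.compHom V φ.toRingHom

open Classical in
/-- The triples `(λ_g, λ_o, λ_p)` that label the one-dimensional representations of `T_e`. -/
noncomputable def oneDimLabels (e : ℕ) : Set (Fin 3 → K) :=
  if e % 3 = 0 then {![0, 0, 0], ![qFact 3, 0, 0], ![0, qFact 3, 0], ![0, 0, qFact 3]}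
  else {![0, 0, 0]}

/-- The nonzero `z` with `(z, z̄) ∈ V_e`. -/
def threeDimLabels (e : ℕ) : Set ℂ :=
  {z | z ≠ 0 ∧ (z, starRingEnd ℂ z) ∈ vanishingSet e}

/-- The matrices through which `θ_g`, `θ_o`, `θ_p` act on the representation `M_z`. -/
noncomputable def repMatrix (z : ℂ) : Fin 3 → Matrix (Fin 3) (Fin 3) K :=
  ![qNum 2 • !![qNum 3, RatFunc.C (starRingEnd ℂ z), RatFunc.C z; 0, 0, 0; 0, 0, 0],
    qNum 2 • !![0, 0, 0; RatFunc.C z, qNum 3, RatFunc.C (starRingEnd ℂ z); 0, 0, 0],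
    qNum 2 • !![0, 0, 0; 0, 0, 0; RatFunc.C (starRingEnd ℂ z), RatFunc.C z, qNum 3]]

end Trihedral

/-!
The monomials of `p_{m,n}` are `X^m Y^n` and monomials `X^k Y^l` of lower degree and of the same
triality `k + 2 l` modulo `3` (`koornwinder_sub_monomial_mem`). Everything rests on this and on the Weyl
character formula.

*The vanishing set.* Let `x, y, z` be roots of unity of order dividing `3 (e + 3)` with `x y z = 1`,
pairwise different, but with equal powers of exponent `e + 3`. Then the numerator of the Weyl character
formula vanishes for `m + n = e + 1` and the denominator does not, so `(x + y + z, xy + xz + yz)` is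
a point of `V_e`; its second coordinate is the conjugate of the first. The multisets `{x, y, z}` are
labelled by pairs `(a, b)` with `a + b ≤ e`, so there are `t_e` of them (`point_mem`, `point_injOn`).
Conversely, by reduction modulo the leading terms, the `t_e` monomials of degree at most `e` span all
functions on every finite subset of `V_e` (`span_monomialFun`). Hence these are all the points
(`vanishingSet_eq`), and the monomials of degree at most `e` are linearly independent on `V_e`
(`eq_zero_of_vanishing`).

*The algebra.* The same reduction shows that `T_e` is spanned by `1` and the `h^{k,l}_u` with
`k + l ≤ e` (`span_spanningFamily`). On `M_z` the element `h^{k,l}_u` acts as a multiple, by a power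
of `[2]` and by `z^k z̄^l`, of a matrix with a single nonzero row, which is row `u` of a circulant matrix
(`repInf_h`). The circulant matrix is invertible, because `[3]` is not a constant. So if an element
of `T_e` acts as zero on all `M_z` and on all one-dimensional representations, then its coefficients
form polynomials of degree at most `e` that vanish on `V_e`, and it is zero (`eq_zero_of_reps`).
Therefore `T_e` embeds, as a left module, into a finite sum of the listed simple modules; this
gives semisimplicity and the completeness of the list (`isSemisimpleRing_of_faithful`).

Isomorphic modules have the same annihilator, which tells the listed modules apart: `M_z` determines
`z ^ 3`. Diagonal matrices intertwine `M_z` and `M_{ζz}`.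
-/

namespace Trihedral

open MvPolynomial

/-! ### The leading term of Koornwinder's polynomials -/

/-- The polynomials all of whose monomials `X^k Y^l` have degree `k + l < d` and triality
`k + 2 l ≡ r` modulo `3`. -/
noncomputable def lowerTerms (d r : ℕ) : Submodule ℤ (MvPolynomial (Fin 2) ℤ) :=
  restrictSupport ℤ {s | s 0 + s 1 < d ∧ (s 0 + 2 * s 1) % 3 = r % 3}

/-- The exponent vector of `X^m Y^n`. -/
noncomputable def expVec (m n : ℕ) : Fin 2 →₀ ℕ := Finsupp.single 0 m + Finsupp.single 1 n

@[simp] lemma expVec_zero (m n : ℕ) : expVec m n 0 = m := by simp [expVec]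

@[simp] lemma expVec_one (m n : ℕ) : expVec m n 1 = n := by simp [expVec]

lemma eq_expVec (s : Fin 2 →₀ ℕ) : s = expVec (s 0) (s 1) := by
  ext i; fin_cases i <;> simp

lemma monomial_expVec_mem {m n d r : ℕ} (hd : m + n < d) (hr : (m + 2 * n) % 3 = r % 3) :
    monomial (expVec m n) (1 : ℤ) ∈ lowerTerms d r := by
  rw [lowerTerms, monomial_mem_restrictSupport]
  left; simpa using ⟨hd, hr⟩

lemma lowerTerms_mono {d d' r r' : ℕ} (hd : d ≤ d') (hr : r % 3 = r' % 3) :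
    lowerTerms d r ≤ lowerTerms d' r' :=
  restrictSupport_mono _ fun _ hs => ⟨hs.1.trans_le hd, hs.2.trans hr⟩

lemma X_mul_monomial_expVec_zero (m n : ℕ) :
    X 0 * monomial (expVec m n) (1 : ℤ) = monomial (expVec (m + 1) n) 1 := by
  rw [X, monomial_mul, one_mul]
  congr 1; rw [eq_expVec (_ + _)]; simp [add_comm]

lemma X_mul_monomial_expVec_one (m n : ℕ) :
    X 1 * monomial (expVec m n) (1 : ℤ) = monomial (expVec m (n + 1)) 1 := by
  rw [X, monomial_mul, one_mul]
  congr 1; rw [eq_expVec (_ + _)]; simp [add_comm]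

lemma X_mul_mem_lowerTerms (i : Fin 2) {p : MvPolynomial (Fin 2) ℤ} {d r : ℕ}
    (hp : p ∈ lowerTerms d r) : X i * p ∈ lowerTerms (d + 1) (r + 1 + i) := by
  rw [lowerTerms, mem_restrictSupport_iff] at hp ⊢
  intro s hs
  rw [Finset.mem_coe, support_X_mul, Finset.mem_map] at hs
  obtain ⟨t, ht, rfl⟩ := hs
  obtain ⟨h1, h2⟩ := hp ht
  fin_cases i <;> simp at h1 h2 ⊢ <;> omega

lemma koornwinder_sub_monomial_mem (m n : ℕ) :
    koornwinder m n - monomial (expVec m n) 1 ∈ lowerTerms (m + n) (m + 2 * n) := by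
  have key : ∀ {m n d r : ℕ}, m + n < d → (m + 2 * n) % 3 = r % 3 →
      koornwinder m n - monomial (expVec m n) 1 ∈ lowerTerms (m + n) (m + 2 * n) →
      koornwinder m n ∈ lowerTerms d r := by
    intro m n d r hd hr hk
    rw [← sub_add_cancel (koornwinder m n) (monomial (expVec m n) 1)]
    exact add_mem (lowerTerms_mono hd.le hr hk) (monomial_expVec_mem hd hr)
  induction m, n using koornwinder.induct with
  | case1 =>
    have : expVec 0 0 = 0 := by simp [expVec]
    simp [koornwinder, this]
  | case2 =>
    have : monomial (expVec 0 1) (1 : ℤ) = X 1 := by simp [expVec, X]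
    simp [koornwinder, this]
  | case3 n h1 h2 =>
    rw [koornwinder, ← X_mul_monomial_expVec_one, sub_right_comm, ← mul_sub]
    refine sub_mem (lowerTerms_mono ?_ ?_ (X_mul_mem_lowerTerms 1 h1)) (key ?_ ?_ h2)
    all_goals simp; try omega
  | case4 =>
    have : monomial (expVec 1 0) (1 : ℤ) = X 0 := by simp [expVec, X]
    simp [koornwinder, this]
  | case5 n h1 h2 =>
    rw [koornwinder, ← zero_add 1, ← X_mul_monomial_expVec_zero, sub_right_comm, ← mul_sub]
    refine sub_mem (lowerTerms_mono ?_ ?_ (X_mul_mem_lowerTerms 0 h1)) (key ?_ ?_ h2)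
    all_goals simp; try omega
  | case6 m h1 h2 =>
    rw [koornwinder, ← X_mul_monomial_expVec_zero, sub_right_comm, ← mul_sub]
    refine sub_mem (lowerTerms_mono ?_ ?_ (X_mul_mem_lowerTerms 0 h1)) (key ?_ ?_ h2)
    all_goals simp; try omega
  | case7 m n h1 h2 h3 =>
    rw [koornwinder, ← X_mul_monomial_expVec_zero, sub_right_comm, sub_right_comm _ (koornwinder _ _),
      ← mul_sub]
    refine sub_mem (sub_mem (lowerTerms_mono ?_ ?_ (X_mul_mem_lowerTerms 0 h1)) (key ?_ ?_ h2))
      (key ?_ ?_ h3)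
    all_goals simp; try omega

lemma coeff_koornwinder_of_ne {m n : ℕ} {s : Fin 2 →₀ ℕ} (hs : s ∈ (koornwinder m n).support)
    (hne : s ≠ expVec m n) : s 0 + s 1 < m + n ∧ (s 0 + 2 * s 1) % 3 = (m + 2 * n) % 3 := by
  have h := koornwinder_sub_monomial_mem m n
  rw [lowerTerms, mem_restrictSupport_iff] at h
  apply h
  simpa [coeff_monomial, hne.symm] using hs

lemma coeff_koornwinder_self (m n : ℕ) : coeff (expVec m n) (koornwinder m n) = 1 := by
  have h := koornwinder_sub_monomial_mem m n
  rw [lowerTerms, mem_restrictSupport_iff] at h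
  by_contra hc
  have : expVec m n ∈ (koornwinder m n - monomial (expVec m n) 1).support := by
    simpa [coeff_monomial, sub_eq_zero] using hc
  simpa using (h this).1

lemma triality_of_mem_support {m n : ℕ} {s : Fin 2 →₀ ℕ} (hs : s ∈ (koornwinder m n).support) :
    (s 0 + 2 * s 1) % 3 = (m + 2 * n) % 3 := by
  by_cases h : s = expVec m n
  · simp [h]
  · exact (coeff_koornwinder_of_ne hs h).2

/-- If `p_{m,n}`, with `X^k Y^l` replaced by `g k l`, gives an element of `W`, and `W` contains the
`g k l` of lower degree, then it contains the leading one. -/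
lemma leading_mem {M : Type*} [AddCommGroup M] (W : AddSubgroup M) (g : ℕ → ℕ → M) {m n : ℕ}
    (hsum : ∑ s ∈ (koornwinder m n).support, coeff s (koornwinder m n) • g (s 0) (s 1) ∈ W)
    (hlow : ∀ k l, k + l < m + n → g k l ∈ W) : g m n ∈ W := by
  have hmem : expVec m n ∈ (koornwinder m n).support := by
    simp [mem_support_iff, coeff_koornwinder_self]
  rw [← Finset.add_sum_erase _ _ hmem, coeff_koornwinder_self, one_smul, expVec_zero,
    expVec_one] at hsum
  refine (W.add_mem_cancel_right (sum_mem fun s hs => ?_)).1 hsum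
  rw [Finset.mem_erase] at hs
  exact zsmul_mem (hlow _ _ (coeff_koornwinder_of_ne hs.2 hs.1).1) _

lemma aeval_koornwinder {R : Type*} [CommRing R] (x y : R) (m n : ℕ) :
    aeval ![x, y] (koornwinder m n) =
      ∑ s ∈ (koornwinder m n).support, coeff s (koornwinder m n) • (x ^ s 0 * y ^ s 1) := by
  simp [aeval_def, eval₂_eq', Fin.prod_univ_two, zsmul_eq_mul]

/-! ### Explicit points of the vanishing set -/

/-- The roots of unity of order dividing `3 (e + 3)`, indexed by their exponent. -/
noncomputable def torus (e : ℕ) (r : ℤ) : ℂ :=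
  Complex.exp (r * (2 * Real.pi * Complex.I / (3 * (e + 3))))

lemma torus_add (e : ℕ) (r s : ℤ) : torus e (r + s) = torus e r * torus e s := by
  rw [torus, torus, torus, ← Complex.exp_add]; push_cast; ring_nf

lemma torus_zero (e : ℕ) : torus e 0 = 1 := by simp [torus]

lemma torus_pow (e : ℕ) (r : ℤ) (n : ℕ) : torus e r ^ n = torus e (n * r) := by
  rw [torus, torus, ← Complex.exp_nat_mul]; push_cast; ring_nf

lemma conj_torus (e : ℕ) (r : ℤ) : starRingEnd ℂ (torus e r) = torus e (-r) := by
  rw [torus, torus, ← Complex.exp_conj]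
  congr 1
  simp only [map_mul, map_div₀, Complex.conj_I, Complex.conj_ofReal, map_ofNat, map_add,
    map_natCast, map_intCast]
  push_cast; ring

lemma torus_eq_iff (e : ℕ) (r s : ℤ) :
    torus e r = torus e s ↔ ∃ k : ℤ, r = s + k * (3 * (e + 3)) := by
  rw [torus, torus, Complex.exp_eq_exp_iff_exists_int]
  have hN : (3 * (e + 3) : ℂ) ≠ 0 := by norm_cast
  have hI := Complex.two_pi_I_ne_zero
  refine exists_congr fun k => ?_
  rw [mul_div_assoc', mul_div_assoc', div_eq_iff hN, add_mul, div_mul_cancel₀ _ hN]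
  constructor
  · intro h
    have h2 : (2 * Real.pi * Complex.I : ℂ) * r =
        (2 * Real.pi * Complex.I) * (s + k * (3 * (e + 3))) := by linear_combination h
    exact_mod_cast mul_left_cancel₀ hI h2
  · rintro rfl
    push_cast; ring

lemma torus_ne {e : ℕ} {r s : ℤ} (h0 : s < r) (h1 : r < s + 3 * (e + 3)) :
    torus e r ≠ torus e s := by
  rw [Ne, torus_eq_iff]
  rintro ⟨k, rfl⟩
  have h2 : k * (3 * (e + 3)) < 1 * (3 * ((e : ℤ) + 3)) := by omega
  have := pos_of_mul_pos_left (show (0 : ℤ) < k * (3 * (e + 3)) by omega) (by positivity)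
  have := lt_of_mul_lt_mul_right h2 (by positivity)
  omega

/-- Two exponents that are congruent modulo `3` become equal after raising to the power `e + 3`. -/
lemma torus_pow_eq {e : ℕ} {r s : ℤ} (k : ℤ) (h : r = s + 3 * k) :
    torus e r ^ (e + 3) = torus e s ^ (e + 3) := by
  rw [torus_pow, torus_pow, torus_eq_iff]
  exact ⟨k, by rw [h]; push_cast; ring⟩

/-- The pairs of natural numbers with sum at most `e`. They label the monomials `X^k Y^l` of degree
at most `e` as well as the points of `V_e`. -/
def degreeLE (e : ℕ) : Finset (ℕ × ℕ) :=
  (Finset.range (e + 1)).biUnion fun d => Finset.HasAntidiagonal.antidiagonal d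

@[simp] lemma mem_degreeLE {e : ℕ} {d : ℕ × ℕ} : d ∈ degreeLE e ↔ d.1 + d.2 ≤ e := by
  simp [degreeLE]

lemma card_degreeLE (e : ℕ) : (degreeLE e).card = triangular e := by
  rw [degreeLE, Finset.card_biUnion]
  · simp only [Finset.Nat.card_antidiagonal]
    have := Finset.sum_range_id_mul_two (e + 2)
    rw [Finset.sum_range_succ'] at this
    rw [triangular]
    simp at this
    rw [mul_comm (e + 1), ← this, Nat.mul_div_cancel _ two_pos]
  · intro i _ j _ hij
    rw [Function.onFun, Finset.disjoint_left]
    intro d h1 h2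
    rw [Finset.HasAntidiagonal.mem_antidiagonal] at h1 h2
    exact hij (h1.symm.trans h2)

/-- The exponents `r, s, t` of the torus element that is labelled by `(a, b)`: the consecutive
differences are `3 (a + 1)` and `3 (b + 1)`, and the sum is zero. -/
def exponent (d : ℕ × ℕ) : Fin 3 → ℤ :=
  ![2 * d.1 + d.2 + 3, d.2 - d.1, -(d.1 + 2 * d.2 + 3)]

/-- The point of `V_e` labelled by `(a, b)`: the values of the two fundamental characters of `SL₃`
at a diagonal matrix. -/
noncomputable def point (e : ℕ) (d : ℕ × ℕ) : ℂ × ℂ :=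
  let x := fun i => torus e (exponent d i)
  (x 0 + x 1 + x 2, x 0 * x 1 + x 0 * x 2 + x 1 * x 2)

lemma torus_exponent_prod (e : ℕ) (d : ℕ × ℕ) :
    torus e (exponent d 0) * torus e (exponent d 1) * torus e (exponent d 2) = 1 := by
  rw [← torus_add, ← torus_add, ← torus_zero e]
  congr 1
  simp [exponent]; ring

lemma point_snd (e : ℕ) (d : ℕ × ℕ) : (point e d).2 = starRingEnd ℂ (point e d).1 := by
  have h01 : exponent d 0 + exponent d 1 = -exponent d 2 := by simp [exponent]; ring
  have h02 : exponent d 0 + exponent d 2 = -exponent d 1 := by simp [exponent]; ring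
  have h12 : exponent d 1 + exponent d 2 = -exponent d 0 := by simp [exponent]; ring
  simp only [point, map_add, conj_torus, ← torus_add, h01, h02, h12]
  ring

lemma point_mem (e : ℕ) {d : ℕ × ℕ} (hd : d ∈ degreeLE e) : point e d ∈ vanishingSet e := by
  intro m n hmn
  rw [mem_degreeLE] at hd
  have hw := koornwinder_weyl_character _ _ _ (torus_exponent_prod e d) m n
  have h01 : torus e (exponent d 0) ≠ torus e (exponent d 1) :=
    torus_ne (by simp [exponent]; omega) (by simp [exponent]; omega)
  have h12 : torus e (exponent d 1) ≠ torus e (exponent d 2) :=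
    torus_ne (by simp [exponent]; omega) (by simp [exponent]; omega)
  have h02 : torus e (exponent d 0) ≠ torus e (exponent d 2) :=
    torus_ne (by simp [exponent]; omega) (by simp [exponent]; omega)
  have p01 := torus_pow_eq (e := e) (r := exponent d 0) (s := exponent d 1) (d.1 + 1)
    (by simp [exponent]; ring)
  have p12 := torus_pow_eq (e := e) (r := exponent d 1) (s := exponent d 2) (d.2 + 1)
    (by simp [exponent]; ring)
  rw [show m + n + 2 = e + 3 by omega, p01, p12] at hw
  simp only [point]
  generalize torus e (exponent d 0) = x at *
  generalize torus e (exponent d 1) = y at *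
  generalize torus e (exponent d 2) = z at *
  -- The left determinant is the Vandermonde determinant, the right one has proportional columns.
  have hV : (x - y) * (x - z) * (y - z) ≠ 0 :=
    mul_ne_zero (mul_ne_zero (sub_ne_zero.2 h01) (sub_ne_zero.2 h02)) (sub_ne_zero.2 h12)
  refine (mul_eq_zero.1 ?_).resolve_right hV
  simp [Matrix.det_fin_three] at hw
  linear_combination hw

/-- A point determines the polynomial with roots `x, y, z`, and hence these roots. -/
lemma exponent_mem_of_point_eq {e : ℕ} {d d' : ℕ × ℕ} (h : point e d = point e d') (i : Fin 3) :
    torus e (exponent d i) = torus e (exponent d' 0) ∨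
      torus e (exponent d i) = torus e (exponent d' 1) ∨
      torus e (exponent d i) = torus e (exponent d' 2) := by
  have h1 := torus_exponent_prod e d
  have h2 := torus_exponent_prod e d'
  simp only [point, Prod.mk.injEq] at h
  rw [← or_assoc]
  have hx : ∀ x : ℂ, (x - torus e (exponent d 0)) * (x - torus e (exponent d 1)) *
      (x - torus e (exponent d 2)) = (x - torus e (exponent d' 0)) *
      (x - torus e (exponent d' 1)) * (x - torus e (exponent d' 2)) := by
    intro x
    linear_combination (-x ^ 2) * h.1 + x * h.2 - h1 + h2
  rw [← sub_eq_zero, ← sub_eq_zero (b := torus e (exponent d' 1)),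
    ← sub_eq_zero (b := torus e (exponent d' 2)), ← mul_eq_zero, ← mul_eq_zero, ← hx]
  fin_cases i <;> simp

/-- The differences of the exponents, in cyclic order, are `3 (a + 1)`, `3 (b + 1)` and
`3 (e + 1 - a - b)`, so a different label with the same multiset of roots of unity could only arise
by a cyclic rotation, which is incompatible with the sum of the exponents being zero. -/
lemma point_injOn (e : ℕ) : Set.InjOn (point e) (degreeLE e) := by
  intro d hd d' hd' h
  rw [Finset.mem_coe, mem_degreeLE] at hd hd'
  have hmem := exponent_mem_of_point_eq h
  obtain ⟨a, b⟩ := d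
  obtain ⟨a', b'⟩ := d'
  have aux : ∀ k x : ℤ, x = k * (3 * (e + 3)) → -(4 * (e + 3)) < x → x < 4 * (e + 3) →
      k = -1 ∨ k = 0 ∨ k = 1 := by
    intro k x hx h1 h2
    have h3 : k < 2 := by nlinarith
    have h4 : -2 < k := by nlinarith
    omega
  have h0 := hmem 0
  have h1 := hmem 1
  have h2 := hmem 2
  simp only [torus_eq_iff, exponent, Matrix.cons_val_zero,
    Matrix.cons_val_one, Matrix.cons_val] at h0 h1 h2 hd hd'
  have red : ∀ r s : ℤ, (∃ k : ℤ, r = s + k * (3 * (e + 3))) → -(4 * (e + 3)) < r - s →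
      r - s < 4 * (e + 3) → r = s - 3 * (e + 3) ∨ r = s ∨ r = s + 3 * (e + 3) := by
    rintro r s ⟨k, hk⟩ hl hu
    obtain rfl | rfl | rfl := aux k (r - s) (by rw [hk]; ring) hl hu <;> omega
  -- The exponents are bounded, so congruence modulo `3 (e + 3)` leaves one possibility for each pair;
  -- since the exponents have sum zero, the cyclic rotations are then excluded as well.
  have r0 : (2 * a + b + 3 : ℤ) = 2 * a' + b' + 3 ∨ (2 * a + b + 3 : ℤ) = b' - a' ∨
      (2 * a + b + 3 : ℤ) = -(a' + 2 * b' + 3) + 3 * (e + 3) := by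
    obtain h | h | h := h0 <;> have := red _ _ h (by omega) (by omega) <;> omega
  have r1 : (b - a : ℤ) = 2 * a' + b' + 3 ∨ (b - a : ℤ) = b' - a' ∨
      (b - a : ℤ) = -(a' + 2 * b' + 3) := by
    obtain h | h | h := h1 <;> have := red _ _ h (by omega) (by omega) <;> omega
  have r2 : (-(a + 2 * b + 3) : ℤ) = 2 * a' + b' + 3 - 3 * (e + 3) ∨
      (-(a + 2 * b + 3) : ℤ) = b' - a' ∨ (-(a + 2 * b + 3) : ℤ) = -(a' + 2 * b' + 3) := by
    obtain h | h | h := h2 <;> have := red _ _ h (by omega) (by omega) <;> omega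
  ext <;> simp only <;> omega

/-! ### Monomials of degree at most `e` as functions on the vanishing set -/

/-- The monomial `X^k Y^l` as a function on a set of points. -/
def monomialFun (S : Finset (ℂ × ℂ)) (k l : ℕ) : S → ℂ := fun p => p.1.1 ^ k * p.1.2 ^ l

lemma monomialFun_mem_span {e : ℕ} {S : Finset (ℂ × ℂ)} (hS : ↑S ⊆ vanishingSet e) :
    let W := Submodule.span ℂ (Set.range fun d : degreeLE e => monomialFun S d.1.1 d.1.2)
    1 ∈ W ∧ (∀ f ∈ W, (fun p : S => p.1.1) * f ∈ W) ∧ (∀ f ∈ W, (fun p : S => p.1.2) * f ∈ W) := by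
  intro W
  have hlow : ∀ k l, k + l ≤ e → monomialFun S k l ∈ W := fun k l h =>
    Submodule.subset_span ⟨⟨(k, l), by simpa using h⟩, rfl⟩
  have htop : ∀ k l, k + l ≤ e + 1 → monomialFun S k l ∈ W := by
    intro k l h
    rcases Nat.lt_or_eq_of_le h with h | h
    · exact hlow k l (by omega)
    · refine leading_mem W.toAddSubgroup (monomialFun S) ?_ fun k' l' h' => hlow k' l' (by omega)
      convert W.zero_mem using 1
      rw [Submodule.mem_toAddSubgroup]
      congr! 1
      ext p
      have := hS p.2 k l h
      rw [aeval_koornwinder] at this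
      simpa [monomialFun] using this
  refine ⟨?_, fun f hf => ?_, fun f hf => ?_⟩
  · convert hlow 0 0 (by omega) using 1
    ext p; simp [monomialFun]
  · induction hf using Submodule.span_induction with
    | mem f hf =>
      obtain ⟨⟨⟨k, l⟩, hd⟩, rfl⟩ := hf
      rw [mem_degreeLE] at hd
      convert htop (k + 1) l (by simp at hd; omega) using 1
      ext p; simp [monomialFun]; ring
    | zero => simp
    | add f g _ _ hf hg => rw [mul_add]; exact add_mem hf hg
    | smul a f _ hf => rw [mul_smul_comm]; exact W.smul_mem a hf
  · induction hf using Submodule.span_induction with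
    | mem f hf =>
      obtain ⟨⟨⟨k, l⟩, hd⟩, rfl⟩ := hf
      rw [mem_degreeLE] at hd
      convert htop k (l + 1) (by simp at hd; omega) using 1
      ext p; simp [monomialFun]; ring
    | zero => simp
    | add f g _ _ hf hg => rw [mul_add]; exact add_mem hf hg
    | smul a f _ hf => rw [mul_smul_comm]; exact W.smul_mem a hf

/-- By reduction of the degree modulo the `p_{m,n}` with `m + n = e + 1`, and since polynomials separate
points, every function on a finite part of `V_e` is a combination of monomials of degree at most `e`. -/
lemma span_monomialFun {e : ℕ} {S : Finset (ℂ × ℂ)} (hS : ↑S ⊆ vanishingSet e) :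
    Submodule.span ℂ (Set.range fun d : degreeLE e => monomialFun S d.1.1 d.1.2) = ⊤ := by
  classical
  obtain ⟨h1, hx, hy⟩ := monomialFun_mem_span hS
  set W := Submodule.span ℂ (Set.range fun d : degreeLE e => monomialFun S d.1.1 d.1.2)
  have hsingle : ∀ p : S, Pi.single p (1 : ℂ) ∈ W := by
    intro p
    -- an affine function that vanishes at `q` and not at `p`
    let g : S → S → ℂ := fun q r => if p.1.1 = q.1.1 then r.1.2 - q.1.2 else r.1.1 - q.1.1
    have hgp : ∀ q, q ≠ p → g q p ≠ 0 := by
      intro q hq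
      simp only [g]
      split_ifs with h
      · exact sub_ne_zero.2 fun h' => hq (Subtype.ext (Prod.ext h.symm h'.symm))
      · exact sub_ne_zero.2 h
    have hgq : ∀ q, g q q = 0 := by intro q; simp [g]
    have hg : ∀ q, ∀ f ∈ W, g q * f ∈ W := by
      intro q f hf
      simp only [g]
      split_ifs with h
      · convert sub_mem (hy f hf) (W.smul_mem q.1.2 hf) using 1
        ext r; simp [sub_mul]
      · convert sub_mem (hx f hf) (W.smul_mem q.1.1 hf) using 1
        ext r; simp [sub_mul]
    have hprod : ∀ T : Finset S, ∏ q ∈ T, g q ∈ W := by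
      intro T
      induction T using Finset.induction_on with
      | empty => simpa using h1
      | insert q T hq ih => rw [Finset.prod_insert hq]; exact hg q _ ih
    convert W.smul_mem (∏ q ∈ Finset.univ.erase p, g q p)⁻¹ (hprod (Finset.univ.erase p)) using 1
    ext r
    rw [Pi.smul_apply, Finset.prod_apply, smul_eq_mul]
    rcases eq_or_ne r p with rfl | hr
    · rw [Pi.single_eq_same, inv_mul_cancel₀]
      exact Finset.prod_ne_zero_iff.2 fun q hq => hgp q (Finset.ne_of_mem_erase hq)
    · rw [Pi.single_eq_of_ne hr, Finset.prod_eq_zero (f := fun q => g q r)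
        (Finset.mem_erase.2 ⟨hr, Finset.mem_univ r⟩) (hgq r), mul_zero]
  refine Submodule.eq_top_iff'.2 fun f => ?_
  rw [pi_eq_sum_univ' f]
  exact sum_mem fun p _ => W.smul_mem _ (hsingle p)

lemma card_le_of_subset_vanishingSet {e : ℕ} {S : Finset (ℂ × ℂ)} (hS : ↑S ⊆ vanishingSet e) :
    S.card ≤ (degreeLE e).card := by
  have h := finrank_range_le_card (R := ℂ) fun d : degreeLE e => monomialFun S d.1.1 d.1.2
  rw [Set.finrank, span_monomialFun hS, finrank_top, Module.finrank_fintype_fun_eq_card] at h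
  simpa using h

/-- The points of `V_e`. -/
noncomputable def points (e : ℕ) : Finset (ℂ × ℂ) := (degreeLE e).image (point e)

lemma card_points (e : ℕ) : (points e).card = (degreeLE e).card :=
  Finset.card_image_of_injOn (point_injOn e)

lemma vanishingSet_eq (e : ℕ) : vanishingSet e = points e := by
  classical
  have hsub : ↑(points e) ⊆ vanishingSet e := by
    intro p hp
    rw [points, Finset.coe_image] at hp
    obtain ⟨d, hd, rfl⟩ := hp
    exact point_mem e hd
  refine (Set.Subset.antisymm hsub fun p hp => ?_).symm
  by_contra hn
  have hS : ↑(insert p (points e)) ⊆ vanishingSet e := by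
    rw [Finset.coe_insert]; exact Set.insert_subset hp hsub
  have := card_le_of_subset_vanishingSet hS
  rw [Finset.card_insert_of_notMem hn, card_points] at this
  omega

lemma snd_eq_of_mem_vanishingSet {e : ℕ} {p : ℂ × ℂ} (hp : p ∈ vanishingSet e) :
    p.2 = starRingEnd ℂ p.1 := by
  rw [vanishingSet_eq, points, Finset.coe_image] at hp
  obtain ⟨d, -, rfl⟩ := hp
  exact point_snd e d

lemma linearIndependent_monomialFun (e : ℕ) :
    LinearIndependent ℂ fun d : degreeLE e => monomialFun (points e) d.1.1 d.1.2 := by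
  refine linearIndependent_of_top_le_span_of_card_eq_finrank
    (span_monomialFun (vanishingSet_eq e).ge).ge ?_
  rw [Module.finrank_fintype_fun_eq_card]
  simp [card_points]

/-- For each monomial of degree at most `e` there is a functional on functions on `V_e` that selects
its coefficient. -/
lemma exists_dual_monomialFun (e : ℕ) (d : degreeLE e) :
    ∃ b : points e → ℂ, ∀ d' : degreeLE e,
      ∑ p, b p * monomialFun (points e) d'.1.1 d'.1.2 p = if d' = d then 1 else 0 := by
  classical
  let B := Module.Basis.mk (linearIndependent_monomialFun e)
    (span_monomialFun (vanishingSet_eq e).ge).ge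
  refine ⟨fun p => B.coord d (Pi.single p 1), fun d' => ?_⟩
  have h1 : B.coord d (monomialFun (points e) d'.1.1 d'.1.2) = if d' = d then 1 else 0 := by
    have : monomialFun (points e) d'.1.1 d'.1.2 = B d' := by simp [B]
    rw [this, Module.Basis.coord_apply, Module.Basis.repr_self, Finsupp.single_apply]
  rw [← h1, pi_eq_sum_univ' (monomialFun (points e) d'.1.1 d'.1.2), map_sum]
  refine Finset.sum_congr rfl fun p _ => ?_
  rw [map_smul, smul_eq_mul, mul_comm, ← pi_eq_sum_univ']

/-- A polynomial of degree at most `e`, with coefficients in `ℂ(v)`, that vanishes on `V_e` is zero. -/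
lemma eq_zero_of_vanishing {e : ℕ} (a : degreeLE e → K)
    (h : ∀ p ∈ vanishingSet e,
      ∑ d : degreeLE e, a d * (RatFunc.C p.1 ^ d.1.1 * RatFunc.C p.2 ^ d.1.2) = 0) : a = 0 := by
  ext d
  obtain ⟨b, hb⟩ := exists_dual_monomialFun e d
  calc a d = ∑ d', a d' * RatFunc.C (if d' = d then 1 else 0) := by
        simp [apply_ite RatFunc.C]
    _ = ∑ d', ∑ p : points e,
          RatFunc.C (b p) * (a d' * (RatFunc.C p.1.1 ^ d'.1.1 * RatFunc.C p.1.2 ^ d'.1.2)) := by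
        refine Finset.sum_congr rfl fun d' _ => ?_
        rw [← hb d', map_sum, Finset.mul_sum]
        refine Finset.sum_congr rfl fun p _ => ?_
        simp only [monomialFun, map_mul, map_pow]; ring
    _ = 0 := by
        rw [Finset.sum_comm]
        refine Finset.sum_eq_zero fun p _ => ?_
        rw [← Finset.mul_sum, h p (by rw [vanishingSet_eq]; exact p.2), mul_zero]

/-! ### The constant terms of Koornwinder's polynomials -/

lemma constantCoeff_koornwinder (m n : ℕ) :
    MvPolynomial.constantCoeff (koornwinder m n) =
      if m % 3 = 0 ∧ n % 3 = 0 then 1 else if m % 3 = 1 ∧ n % 3 = 1 then -1 else 0 := by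
  induction m, n using koornwinder.induct with
  | case1 => simp [koornwinder]
  | case2 => simp [koornwinder]
  | case3 n _ h2 =>
    rw [koornwinder]
    simp only [map_sub, map_mul, MvPolynomial.constantCoeff_X, zero_mul, zero_sub]
    rw [h2]
    have hn : n % 3 = 0 ∨ n % 3 = 1 ∨ n % 3 = 2 := by omega
    obtain hn | hn | hn := hn <;> simp [Nat.add_mod, hn]
  | case4 => simp [koornwinder]
  | case5 n _ h2 =>
    rw [koornwinder]
    simp only [map_sub, map_mul, MvPolynomial.constantCoeff_X, zero_mul, zero_sub]
    rw [h2]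
    have hn : n % 3 = 0 ∨ n % 3 = 1 ∨ n % 3 = 2 := by omega
    obtain hn | hn | hn := hn <;> simp [Nat.add_mod, hn]
  | case6 m _ h2 =>
    rw [koornwinder]
    simp only [map_sub, map_mul, MvPolynomial.constantCoeff_X, zero_mul, zero_sub]
    rw [h2]
    have hm : m % 3 = 0 ∨ m % 3 = 1 ∨ m % 3 = 2 := by omega
    obtain hm | hm | hm := hm <;> simp [Nat.add_mod, hm]
  | case7 m n _ h2 h3 =>
    rw [koornwinder]
    simp only [map_sub, map_mul, MvPolynomial.constantCoeff_X, zero_mul, zero_sub]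
    rw [h2, h3]
    have hm : m % 3 = 0 ∨ m % 3 = 1 ∨ m % 3 = 2 := by omega
    have hn : n % 3 = 0 ∨ n % 3 = 1 ∨ n % 3 = 2 := by omega
    obtain hm | hm | hm := hm <;> obtain hn | hn | hn := hn <;> simp [Nat.add_mod, hm, hn]

lemma constantCoeff_koornwinder_eq_zero {e m n : ℕ} (he : e % 3 = 0) (hmn : m + n = e + 1) :
    MvPolynomial.constantCoeff (koornwinder m n) = 0 := by
  rw [constantCoeff_koornwinder]
  split_ifs <;> omega

lemma aeval_zero_koornwinder (m n : ℕ) :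
    MvPolynomial.aeval ![(0 : ℂ), 0] (koornwinder m n) =
      MvPolynomial.constantCoeff (koornwinder m n) := by
  have : (![0, 0] : Fin 2 → ℂ) = 0 := by ext i; fin_cases i <;> rfl
  rw [this, MvPolynomial.aeval_zero]; simp

lemma zero_mem_vanishingSet_iff (e : ℕ) : (0, 0) ∈ vanishingSet e ↔ e % 3 = 0 := by
  constructor
  · intro h
    have h0 := h (e + 1) 0 rfl
    have h1 := h e 1 rfl
    simp only [aeval_zero_koornwinder, constantCoeff_koornwinder, Int.cast_eq_zero] at h0 h1
    by_contra he
    obtain he | he : e % 3 = 1 ∨ e % 3 = 2 := by omega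
    · simp [he] at h1
    · simp [show (e + 1) % 3 = 0 by omega] at h0
  · intro he m n hmn
    rw [aeval_zero_koornwinder, constantCoeff_koornwinder_eq_zero he hmn, Int.cast_zero]

/-! ### Quantum numbers -/

lemma v_eq : v = algebraMap (Polynomial ℂ) K Polynomial.X := RatFunc.algebraMap_X.symm

lemma v_ne_zero : v ≠ 0 := RatFunc.X_ne_zero

/-- A polynomial relation for `v` over `ℂ` is trivial. -/
lemma eq_of_algebraMap_eq {p q : Polynomial ℂ} (h : algebraMap _ K p = algebraMap _ K q) : p = q :=
  RatFunc.algebraMap_injective ℂ h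

lemma v_sub_inv_ne_zero : v - v⁻¹ ≠ 0 := by
  intro h
  have h2 : v ^ 2 = 1 := by
    have := v_ne_zero
    field_simp at h
    linear_combination h
  have h3 : (Polynomial.X ^ 2 : Polynomial ℂ) = 1 :=
    eq_of_algebraMap_eq (by rw [map_pow, ← v_eq, h2, map_one])
  simpa [Polynomial.coeff_one] using congrArg (Polynomial.coeff · 2) h3

lemma qNum_one : qNum 1 = 1 := by
  rw [qNum, zpow_one, zpow_neg_one, div_self v_sub_inv_ne_zero]

lemma qNum_two : qNum 2 = v + v⁻¹ := by
  rw [qNum, div_eq_iff v_sub_inv_ne_zero, zpow_neg]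
  norm_cast
  have := v_ne_zero
  field_simp
  ring

lemma qNum_three : qNum 3 = v ^ 2 + 1 + (v ^ 2)⁻¹ := by
  rw [qNum, div_eq_iff v_sub_inv_ne_zero, zpow_neg]
  norm_cast
  have := v_ne_zero
  field_simp
  ring

lemma qNum_two_ne_zero : qNum 2 ≠ 0 := by
  rw [qNum_two]
  intro h
  have h2 : v ^ 2 + 1 = 0 := by
    have := v_ne_zero
    field_simp at h
    linear_combination h
  have h3 : (Polynomial.X ^ 2 + 1 : Polynomial ℂ) = 0 :=
    eq_of_algebraMap_eq (by rw [map_add, map_pow, ← v_eq, map_one, h2, map_zero])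
  simpa [Polynomial.coeff_one] using congrArg (Polynomial.coeff · 2) h3

lemma qNum_three_ne_C (a : ℂ) : qNum 3 ≠ RatFunc.C a := by
  rw [qNum_three]
  intro h
  have h2 : v ^ 4 + v ^ 2 + 1 = RatFunc.C a * v ^ 2 := by
    have := v_ne_zero
    field_simp at h
    linear_combination h
  have h3 : (Polynomial.X ^ 4 + Polynomial.X ^ 2 + 1 : Polynomial ℂ) =
      Polynomial.C a * Polynomial.X ^ 2 :=
    eq_of_algebraMap_eq (by simp [RatFunc.algebraMap_X, RatFunc.algebraMap_C]; exact h2)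
  simpa [Polynomial.coeff_one, Polynomial.coeff_X_pow] using congrArg (Polynomial.coeff · 4) h3

lemma qNum_three_ne_zero : qNum 3 ≠ 0 := by simpa using qNum_three_ne_C 0

lemma qFact_three : qFact 3 = qNum 2 * qNum 3 := by
  have h1 : ((1 : ℕ) : ℤ) + 1 = 2 := rfl
  have h2 : ((2 : ℕ) : ℤ) + 1 = 3 := rfl
  rw [qFact, Finset.prod_range_succ, Finset.prod_range_succ, Finset.prod_range_one, h1, h2,
    Nat.cast_zero, zero_add, qNum_one, one_mul]

lemma qFact_three_ne_zero : qFact 3 ≠ 0 := by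
  rw [qFact_three]; exact mul_ne_zero qNum_two_ne_zero qNum_three_ne_zero

lemma isPrimitiveRoot_ζ : IsPrimitiveRoot ζ 3 := by
  simpa [ζ] using Complex.isPrimitiveRoot_exp 3 (by norm_num)

lemma ζ_pow_three : ζ ^ 3 = 1 := isPrimitiveRoot_ζ.pow_eq_one

lemma ζ_ne_zero : ζ ≠ 0 := isPrimitiveRoot_ζ.ne_zero (by norm_num)

lemma one_add_ζ_add_sq : 1 + ζ + ζ ^ 2 = 0 := by
  have := isPrimitiveRoot_ζ.geom_sum_eq_zero (by norm_num)
  simpa [Finset.sum_range_succ] using this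

lemma conj_ζ : starRingEnd ℂ ζ = ζ⁻¹ := by
  rw [ζ, ← Complex.exp_conj, ← Complex.exp_neg]
  congr 1
  simp only [map_mul, map_div₀, Complex.conj_I, Complex.conj_ofReal, map_ofNat]
  ring

/-! ### Spanning the trihedral Hecke algebra -/

/-- The color `ρ^k(ρ^{-l}(u))`. -/
def color (u : Fin 3) (k l : ℕ) : Fin 3 := u + k • (1 : Fin 3) - l • (1 : Fin 3)

lemma color_eq (u : Fin 3) {k l m n : ℕ} (h : (k + 2 * l) % 3 = (m + 2 * n) % 3) :
    color u k l = color u m n := by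
  have h3 : (3 : ℕ) • (1 : Fin 3) = 0 := by decide
  have key : ∀ k l : ℕ, color u k l = u + ((k + 2 * l) % 3) • (1 : Fin 3) := by
    intro k l
    have h1 : (k + 2 * l) • (1 : Fin 3) = ((k + 2 * l) % 3) • (1 : Fin 3) := by
      conv_lhs => rw [← Nat.div_add_mod (k + 2 * l) 3, add_nsmul, mul_nsmul, h3, smul_zero, zero_add]
    have h2 : -(l • (1 : Fin 3)) = (2 * l) • (1 : Fin 3) := by
      rw [neg_eq_iff_add_eq_zero, ← add_nsmul, show l + 2 * l = 3 * l by ring, mul_nsmul, h3,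
        smul_zero]
    rw [← h1, color, sub_eq_add_neg, h2, add_nsmul, add_assoc]
  rw [key, key, h]

lemma color_succ_left (u : Fin 3) (k l : ℕ) : color u (k + 1) l = color u k l + 1 := by
  simp only [color, succ_nsmul]; abel

lemma color_succ_right (u : Fin 3) (k l : ℕ) : color u k (l + 1) = color u k l - 1 := by
  simp only [color, succ_nsmul]; abel

lemma h_zero (u : Fin 3) : h u 0 0 = θInf u := by rw [h]

lemma θInf_mul_h_left (u : Fin 3) (k l : ℕ) :
    θInf (color u k l + 1) * h u k l = h u (k + 1) l := by
  rw [← color_succ_left]; exact h_succ_left u k l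

lemma θInf_mul_h_right (u : Fin 3) (k l : ℕ) :
    θInf (color u k l - 1) * h u k l = h u k (l + 1) := by
  rw [← color_succ_right, color, h]

lemma θInf_mul_self (u : Fin 3) : θInf u * θInf u = qFact 3 • θInf u := by
  simpa [θInf] using RingQuot.mkAlgHom_rel K (RelInf.quadratic u)

lemma θInf_mul_h_self (u : Fin 3) (k l : ℕ) :
    θInf (color u k l) * h u k l = qFact 3 • h u k l := by
  obtain ⟨w, hw⟩ := h_leftmost u k l
  rw [hw, color, ← mul_assoc, θInf_mul_self, smul_mul_assoc]

/-- The images in `T_e` of the identity and of the `h^{k,l}_u` with `k + l ≤ e`. -/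
noncomputable def spanningFamily (e : ℕ) : Option (Fin 3 × degreeLE e) → Hecke e
  | none => 1
  | some (u, d) => RingQuot.mkAlgHom K (RelLevel e) (h u d.1.1 d.1.2)

lemma mkAlgHom_c {e m n : ℕ} (u : Fin 3) (hmn : m + n = e + 1) :
    RingQuot.mkAlgHom K (RelLevel e) (c u m n) = 0 := by
  simpa using RingQuot.mkAlgHom_rel K (RelLevel.vanish u m n hmn)

lemma mkAlgHom_h_mem_span {e : ℕ} (u : Fin 3) {k l : ℕ} (hkl : k + l ≤ e + 1) :
    RingQuot.mkAlgHom K (RelLevel e) (h u k l) ∈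
      Submodule.span K (Set.range (spanningFamily e)) := by
  have hlow : ∀ k l, k + l ≤ e → RingQuot.mkAlgHom K (RelLevel e) (h u k l) ∈
      Submodule.span K (Set.range (spanningFamily e)) := fun k l hd =>
    Submodule.subset_span ⟨some (u, ⟨(k, l), by simpa using hd⟩), rfl⟩
  rcases Nat.lt_or_eq_of_le hkl with hd | hd
  · exact hlow k l (by omega)
  · have hne : (qNum 2)⁻¹ ^ (k + l) ≠ 0 := pow_ne_zero _ (inv_ne_zero qNum_two_ne_zero)
    rw [← Submodule.smul_mem_iff _ hne]
    refine leading_mem (m := k) (n := l) (Submodule.span K (Set.range (spanningFamily e))).toAddSubgroup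
      (fun k l => (qNum 2)⁻¹ ^ (k + l) • RingQuot.mkAlgHom K (RelLevel e) (h u k l)) ?_
      fun k' l' h' => Submodule.smul_mem _ _ (hlow k' l' (by omega))
    have hc := mkAlgHom_c u hd
    simp only [c, map_sum, map_smul, mul_comm ((qNum 2)⁻¹ ^ _), mul_smul,
      Int.cast_smul_eq_zsmul, map_zsmul] at hc
    rw [hc]
    exact zero_mem _

/-- Induction principle for `T_e`: it is generated by the `θ_u` as a `ℂ(v)`-algebra. -/
lemma hecke_induction {e : ℕ} {P : Hecke e → Prop} (hK : ∀ r : K, P (algebraMap K _ r))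
    (hθ : ∀ u, P (θ e u)) (hmul : ∀ a b, P a → P b → P (a * b))
    (hadd : ∀ a b, P a → P b → P (a + b)) (a : Hecke e) : P a := by
  obtain ⟨y, rfl⟩ := RingQuot.mkAlgHom_surjective K (RelLevel e) a
  obtain ⟨x, rfl⟩ := RingQuot.mkAlgHom_surjective K RelInf y
  induction x using FreeAlgebra.induction with
  | grade0 r => rw [AlgHom.commutes, AlgHom.commutes]; exact hK r
  | grade1 u => exact hθ u
  | mul x y hx hy => rw [map_mul, map_mul]; exact hmul _ _ hx hy
  | add x y hx hy => rw [map_add, map_add]; exact hadd _ _ hx hy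

/-- The algebra `T_e` is spanned by the identity and the `h^{k,l}_u` with `k + l ≤ e`: the span is
stable under left multiplication by the generators. -/
lemma span_spanningFamily (e : ℕ) : Submodule.span K (Set.range (spanningFamily e)) = ⊤ := by
  set W := Submodule.span K (Set.range (spanningFamily e))
  have hθ : ∀ u, ∀ w ∈ W, θ e u * w ∈ W := by
    intro u w hw
    induction hw using Submodule.span_induction with
    | mem w hw =>
      obtain ⟨_ | ⟨u', ⟨⟨k, l⟩, hd⟩⟩, rfl⟩ := hw
      · rw [spanningFamily, mul_one, θ, ← h_zero]
        exact mkAlgHom_h_mem_span u (by omega)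
      · rw [mem_degreeLE] at hd
        simp only at hd
        rw [spanningFamily, θ, ← map_mul]
        have hu : ∀ a b : Fin 3, a = b ∨ a = b + 1 ∨ a = b - 1 := by decide
        obtain rfl | rfl | rfl := hu u (color u' k l)
        · rw [θInf_mul_h_self, map_smul]
          exact W.smul_mem _ (mkAlgHom_h_mem_span u' (by omega))
        · rw [θInf_mul_h_left]
          exact mkAlgHom_h_mem_span u' (by omega)
        · rw [θInf_mul_h_right]
          exact mkAlgHom_h_mem_span u' (by omega)
    | zero => simp
    | add f g _ _ hf hg => rw [mul_add]; exact add_mem hf hg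
    | smul a f _ hf => rw [mul_smul_comm]; exact W.smul_mem a hf
  have h1 : (1 : Hecke e) ∈ W := Submodule.subset_span ⟨none, rfl⟩
  have hmul : ∀ a : Hecke e, ∀ w ∈ W, a * w ∈ W := by
    intro a
    induction a using hecke_induction with
    | hK r => intro w hw; rw [← Algebra.smul_def]; exact W.smul_mem _ hw
    | hθ u => exact hθ u
    | hmul a b ha hb => intro w hw; rw [mul_assoc]; exact ha _ (hb _ hw)
    | hadd a b ha hb => intro w hw; rw [add_mul]; exact add_mem (ha _ hw) (hb _ hw)
  exact Submodule.eq_top_iff'.2 fun a => by simpa using hmul a 1 h1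

/-- An algebra homomorphism out of `T_∞`, given by the images of the generators. -/
noncomputable def liftInf {B : Type} [Ring B] [Algebra K B] (f : Fin 3 → B)
    (hq : ∀ u, f u * f u = qFact 3 • f u) (hc : ∀ u, f u * f (u + 1) * f u = f u * f (u - 1) * f u) :
    HeckeInf →ₐ[K] B :=
  RingQuot.liftAlgHom K ⟨FreeAlgebra.lift K f, by
    intro x y hxy
    cases hxy with
    | quadratic u => simpa using hq u
    | cubic u => simpa using hc u⟩

lemma liftInf_θInf {B : Type} [Ring B] [Algebra K B] (f : Fin 3 → B)
    (hq : ∀ u, f u * f u = qFact 3 • f u) (hc : ∀ u, f u * f (u + 1) * f u = f u * f (u - 1) * f u)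
    (u : Fin 3) : liftInf f hq hc (θInf u) = f u := by
  rw [θInf, liftInf, RingQuot.liftAlgHom_mkAlgHom_apply, FreeAlgebra.lift_ι_apply]

/-- An algebra homomorphism out of `T_e`, given by one out of `T_∞` that kills the `c^{m,n}_u`. -/
noncomputable def liftLevel {B : Type} [Ring B] [Algebra K B] {e : ℕ} (f : HeckeInf →ₐ[K] B)
    (hf : ∀ u m n, m + n = e + 1 → f (c u m n) = 0) : Hecke e →ₐ[K] B :=
  RingQuot.liftAlgHom K ⟨f, by
    rintro _ _ ⟨u, m, n, hmn⟩
    rw [hf u m n hmn, map_zero]⟩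

lemma liftLevel_mkAlgHom {B : Type} [Ring B] [Algebra K B] {e : ℕ} (f : HeckeInf →ₐ[K] B)
    (hf : ∀ u m n, m + n = e + 1 → f (c u m n) = 0) (x : HeckeInf) :
    liftLevel f hf (RingQuot.mkAlgHom K (RelLevel e) x) = f x := by
  rw [liftLevel, RingQuot.liftAlgHom_mkAlgHom_apply]

open Matrix

/-! ### The one-dimensional representations -/

/-- The labels of characters: triples with at most one nonzero entry, which is `[3]!`. -/
structure IsCharLabel (e : ℕ) (l : Fin 3 → K) : Prop where
  quadratic : ∀ u, l u * l u = qFact 3 * l u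
  orthogonal : ∀ u w, u ≠ w → l u * l w = 0
  level : ∀ u, l u ≠ 0 → e % 3 = 0

lemma isCharLabel_zero (e : ℕ) : IsCharLabel e 0 := ⟨by simp, by simp, by simp⟩

lemma isCharLabel_single {e : ℕ} (he : e % 3 = 0) (w : Fin 3) :
    IsCharLabel e (Pi.single w (qFact 3)) where
  quadratic u := by by_cases h : u = w <;> simp [h]
  orthogonal u u' h := by
    simp only [Pi.single_apply]
    split_ifs with h1 h2 <;> simp
    exact absurd (h1.trans h2.symm) h
  level _ _ := he

lemma vec_eq_single (x : K) :
    (![x, 0, 0] : Fin 3 → K) = Pi.single 0 x ∧ (![0, x, 0] : Fin 3 → K) = Pi.single 1 x ∧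
      (![0, 0, x] : Fin 3 → K) = Pi.single 2 x := by
  refine ⟨?_, ?_, ?_⟩ <;> ext i <;> fin_cases i <;> simp

lemma vec_eq_zero : (![0, 0, 0] : Fin 3 → K) = 0 := by
  ext i; fin_cases i <;> rfl

lemma mem_oneDimLabels {e : ℕ} {l : Fin 3 → K} :
    l ∈ oneDimLabels e ↔ l = 0 ∨ (e % 3 = 0 ∧ ∃ w, l = Pi.single w (qFact 3)) := by
  obtain ⟨h0, h1, h2⟩ := vec_eq_single (qFact 3)
  rw [oneDimLabels, h0, h1, h2, vec_eq_zero]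
  split_ifs with he
  · simp only [Set.mem_insert_iff, Set.mem_singleton_iff, he, true_and, Fin.exists_fin_succ,
      Fin.exists_fin_zero]
    simp
  · simp [he]

lemma isCharLabel_of_mem {e : ℕ} {l : Fin 3 → K} (hl : l ∈ oneDimLabels e) : IsCharLabel e l := by
  rw [mem_oneDimLabels] at hl
  obtain rfl | ⟨he, w, rfl⟩ := hl
  · exact isCharLabel_zero e
  · exact isCharLabel_single he w

/-- The one-dimensional representation of `T_∞` with the label `l`. -/
noncomputable def charInf {e : ℕ} {l : Fin 3 → K} (hl : IsCharLabel e l) : HeckeInf →ₐ[K] K :=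
  liftInf l (fun u => hl.quadratic u) fun u => by
    rw [hl.orthogonal u (u + 1) (by revert u; decide), hl.orthogonal u (u - 1) (by revert u; decide)]

lemma charInf_h {e : ℕ} {l : Fin 3 → K} (hl : IsCharLabel e l) (u : Fin 3) (k m : ℕ) :
    charInf hl (h u k m) = if k = 0 ∧ m = 0 then l u else 0 := by
  have hθ : ∀ u, charInf hl (θInf u) = l u := liftInf_θInf _ _ _
  have step : ∀ w k m, w ≠ color u k m → charInf hl (θInf w * h u k m) = 0 := by
    intro w k m hw
    obtain ⟨x, hx⟩ := h_leftmost u k m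
    rw [hx, map_mul, map_mul, hθ, hθ, ← mul_assoc]
    erw [hl.orthogonal _ _ hw]
    rw [zero_mul]
  rcases m with _ | m
  · rcases k with _ | k
    · simp [h_zero, hθ]
    · rw [← θInf_mul_h_left, step]
      · simp
      · generalize color u k 0 = w; revert w; decide
  · rw [← θInf_mul_h_right, step]
    · simp
    · generalize color u k m = w; revert w; decide

lemma charInf_c {e : ℕ} {l : Fin 3 → K} (hl : IsCharLabel e l) (u : Fin 3) (m n : ℕ)
    (hmn : m + n = e + 1) : charInf hl (c u m n) = 0 := by
  rw [c, map_sum]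
  refine Finset.sum_eq_zero fun s hs => ?_
  rw [map_smul, charInf_h]
  split_ifs with h0
  · by_cases hlu : l u = 0
    · rw [hlu, smul_zero]
    · have hs0 : s = 0 := by ext i; fin_cases i <;> simp [h0]
      have := constantCoeff_koornwinder_eq_zero (hl.level u hlu) hmn
      rw [MvPolynomial.constantCoeff_eq] at this
      simp [hs0, this]
  · exact smul_zero _

/-- The one-dimensional representation of `T_e` with the label `l`. -/
noncomputable def charLevel {e : ℕ} {l : Fin 3 → K} (hl : IsCharLabel e l) : Hecke e →ₐ[K] K :=
  liftLevel (charInf hl) (charInf_c hl)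

lemma charLevel_h {e : ℕ} {l : Fin 3 → K} (hl : IsCharLabel e l) (u : Fin 3) (k m : ℕ) :
    charLevel hl (RingQuot.mkAlgHom K (RelLevel e) (h u k m)) = if k = 0 ∧ m = 0 then l u else 0 := by
  rw [charLevel, liftLevel_mkAlgHom, charInf_h]

lemma charLevel_θ {e : ℕ} {l : Fin 3 → K} (hl : IsCharLabel e l) (u : Fin 3) :
    charLevel hl (θ e u) = l u := by
  rw [θ, ← h_zero, charLevel_h]; simp

/-! ### The three-dimensional representations -/

/-- The circulant matrix whose `u`-th row is, up to the factor `[2]`, the nonzero row of the matrix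
of `θ_u` on `M_z`. -/
noncomputable def circ (z : ℂ) : Matrix (Fin 3) (Fin 3) K :=
  !![qNum 3, RatFunc.C (starRingEnd ℂ z), RatFunc.C z;
     RatFunc.C z, qNum 3, RatFunc.C (starRingEnd ℂ z);
     RatFunc.C (starRingEnd ℂ z), RatFunc.C z, qNum 3]

/-- The circulant determinant is a product of three factors `[3] + a` with `a ∈ ℂ`, and the quantum
number `[3]` is not a constant. -/
lemma det_circ_ne_zero (z : ℂ) : (circ z).det ≠ 0 := by
  have hζ := congrArg (RatFunc.C (K := ℂ)) one_add_ζ_add_sq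
  have hζ3 := congrArg (RatFunc.C (K := ℂ)) ζ_pow_three
  have hne : ∀ a : ℂ, qNum 3 + RatFunc.C a ≠ 0 := by
    intro a ha
    refine qNum_three_ne_C (-a) ?_
    rw [map_neg]; exact eq_neg_of_add_eq_zero_left ha
  have hfac : (circ z).det = (qNum 3 + RatFunc.C (z + starRingEnd ℂ z)) *
      (qNum 3 + RatFunc.C (ζ * z + ζ ^ 2 * starRingEnd ℂ z)) *
      (qNum 3 + RatFunc.C (ζ ^ 2 * z + ζ * starRingEnd ℂ z)) := by
    simp only [circ, det_fin_three]
    simp only [map_add, map_mul, map_pow, map_one, map_zero] at hζ hζ3 ⊢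
    simp
    generalize RatFunc.C ζ = w at *
    generalize RatFunc.C z = x at *
    generalize RatFunc.C (starRingEnd ℂ z) = y at *
    generalize qNum 3 = q at *
    have hw : w ^ 2 = -1 - w := by linear_combination hζ
    rw [hw]
    ring_nf
    rw [hw]
    ring
  rw [hfac]
  exact mul_ne_zero (mul_ne_zero (hne _) (hne _)) (hne _)

/-- The matrix whose row `w` is the row `u` of the circulant matrix, and whose other rows are zero. -/
noncomputable def rowMatrix (z : ℂ) (w u : Fin 3) : Matrix (Fin 3) (Fin 3) K :=
  vecMulVec (Pi.single w 1) (circ z u)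

lemma rowMatrix_apply (z : ℂ) (w u i j : Fin 3) :
    rowMatrix z w u i j = if i = w then circ z u j else 0 := by
  simp [rowMatrix, vecMulVec_apply, Pi.single_apply]

lemma repMatrix_eq (z : ℂ) (u : Fin 3) : repMatrix z u = qNum 2 • rowMatrix z u u := by
  ext i j
  rw [Matrix.smul_apply, rowMatrix_apply]
  fin_cases u <;> fin_cases i <;> fin_cases j <;> simp [repMatrix, circ]

lemma rowMatrix_mul_rowMatrix (z : ℂ) (w u w' u' : Fin 3) :
    rowMatrix z w u * rowMatrix z w' u' = circ z u w' • rowMatrix z w u' := by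
  rw [rowMatrix, rowMatrix, vecMulVec_mul_vecMulVec]
  simp [rowMatrix, vecMulVec_smul]

lemma circ_diag (z : ℂ) (u : Fin 3) : circ z u u = qNum 3 := by fin_cases u <;> simp [circ]

lemma circ_succ_left (z : ℂ) (u : Fin 3) : circ z (u + 1) u = RatFunc.C z := by
  fin_cases u <;> simp [circ]

lemma circ_succ_right (z : ℂ) (u : Fin 3) :
    circ z u (u + 1) = RatFunc.C (starRingEnd ℂ z) := by
  fin_cases u <;> simp [circ]

lemma circ_pred_left (z : ℂ) (u : Fin 3) :
    circ z (u - 1) u = RatFunc.C (starRingEnd ℂ z) := by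
  simpa using circ_succ_right z (u - 1)

lemma circ_pred_right (z : ℂ) (u : Fin 3) : circ z u (u - 1) = RatFunc.C z := by
  simpa using circ_succ_left z (u - 1)

/-- The representation `M_z` of `T_∞`. -/
noncomputable def repInf (z : ℂ) : HeckeInf →ₐ[K] Matrix (Fin 3) (Fin 3) K :=
  liftInf (repMatrix z)
    (fun u => by
      rw [repMatrix_eq, smul_mul_smul_comm, rowMatrix_mul_rowMatrix, circ_diag, qFact_three,
        smul_smul, smul_smul]
      congr 1; ring)
    (fun u => by
      simp only [repMatrix_eq, rowMatrix_mul_rowMatrix, smul_mul_assoc, mul_smul_comm,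
        circ_succ_left, circ_succ_right, circ_pred_left, circ_pred_right, smul_smul]
      congr 1; ring)

lemma repInf_h (z : ℂ) (u : Fin 3) (k l : ℕ) :
    repInf z (h u k l) = (qNum 2 ^ (k + l + 1) *
      (RatFunc.C z ^ k * RatFunc.C (starRingEnd ℂ z) ^ l)) • rowMatrix z (color u k l) u := by
  have hθ : ∀ u, repInf z (θInf u) = qNum 2 • rowMatrix z u u := fun u => by
    rw [← repMatrix_eq]; exact liftInf_θInf _ _ _ u
  induction l with
  | zero =>
    induction k with
    | zero => simp [h_zero, hθ, color]
    | succ k ih =>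
      rw [← θInf_mul_h_left, map_mul, hθ, ih, color_succ_left, smul_mul_smul_comm,
        rowMatrix_mul_rowMatrix, circ_succ_left, smul_smul]
      congr 1; ring
  | succ l ih =>
    rw [← θInf_mul_h_right, map_mul, hθ, ih, color_succ_right, smul_mul_smul_comm,
      rowMatrix_mul_rowMatrix, circ_pred_left, smul_smul]
    congr 1; ring

lemma repInf_c (z : ℂ) (u : Fin 3) (m n : ℕ) :
    repInf z (c u m n) = (qNum 2 * RatFunc.C (MvPolynomial.aeval ![z, starRingEnd ℂ z]
      (koornwinder m n))) • rowMatrix z (color u m n) u := by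
  rw [c, map_sum, aeval_koornwinder, map_sum, Finset.mul_sum, Finset.sum_smul]
  refine Finset.sum_congr rfl fun s hs => ?_
  rw [map_smul, repInf_h, smul_smul, color_eq u (triality_of_mem_support hs), map_zsmul,
    zsmul_eq_mul, map_mul, map_pow, map_pow, pow_succ, inv_pow]
  congr 1
  have := pow_ne_zero (s 0 + s 1) qNum_two_ne_zero
  field_simp

/-- The representation `M_z` of `T_e`, for a point `(z, z̄)` of `V_e`. -/
noncomputable def repLevel {e : ℕ} {z : ℂ} (hz : (z, starRingEnd ℂ z) ∈ vanishingSet e) :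
    Hecke e →ₐ[K] Matrix (Fin 3) (Fin 3) K :=
  liftLevel (repInf z) fun u m n hmn => by
    rw [repInf_c]
    have := hz m n hmn
    simp only at this
    rw [this, map_zero, mul_zero, zero_smul]

lemma repLevel_h {e : ℕ} {z : ℂ} (hz : (z, starRingEnd ℂ z) ∈ vanishingSet e) (u : Fin 3)
    (k l : ℕ) : repLevel hz (RingQuot.mkAlgHom K (RelLevel e) (h u k l)) = (qNum 2 ^ (k + l + 1) *
      (RatFunc.C z ^ k * RatFunc.C (starRingEnd ℂ z) ^ l)) • rowMatrix z (color u k l) u := by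
  rw [repLevel, liftLevel_mkAlgHom, repInf_h]

lemma repLevel_θ {e : ℕ} {z : ℂ} (hz : (z, starRingEnd ℂ z) ∈ vanishingSet e) (u : Fin 3) :
    repLevel hz (θ e u) = repMatrix z u := by
  rw [θ, ← h_zero, repLevel_h, repMatrix_eq]; simp [color]

/-! ### Joint faithfulness -/

/-- An element of `T_e` that acts as zero in all the representations `M_l` and `M_z` is zero. For each
color `u`, its coefficients at the `h^{k,l}_u` form a polynomial of degree at most `e` that
vanishes on `V_e`. -/
theorem eq_zero_of_reps {e : ℕ} (a : Hecke e)
    (h1 : ∀ l (hl : l ∈ oneDimLabels e), charLevel (isCharLabel_of_mem hl) a = 0)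
    (h3 : ∀ z (hz : z ∈ threeDimLabels e), repLevel hz.2 a = 0) : a = 0 := by
  have ha : a ∈ Submodule.span K (Set.range (spanningFamily e)) := by
    rw [span_spanningFamily]; trivial
  obtain ⟨f, rfl⟩ := (Submodule.mem_span_range_iff_exists_fun K).1 ha
  simp only [Fintype.sum_option, Fintype.sum_prod_type, spanningFamily, map_add, map_sum, map_smul,
    map_one, charLevel_h, repLevel_h] at h1 h3 ⊢
  have hnone : f none = 0 := by simpa using h1 0 (mem_oneDimLabels.2 (Or.inl rfl))
  simp only [hnone, zero_smul, zero_add] at h1 h3 ⊢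
  have key : ∀ u, (fun d : degreeLE e => f (some (u, d)) * qNum 2 ^ (d.1.1 + d.1.2 + 1)) = 0 := by
    intro u
    refine eq_zero_of_vanishing _ fun p hp => ?_
    obtain ⟨z, z'⟩ := p
    obtain rfl : z' = starRingEnd ℂ z := snd_eq_of_mem_vanishingSet hp
    by_cases hz : z = 0
    -- At the origin `M_z` is not available, and the one-dimensional representations take its place.
    · subst hz
      rw [map_zero] at hp
      have he := (zero_mem_vanishingSet_iff e).1 hp
      have := h1 _ (mem_oneDimLabels.2 (Or.inr ⟨he, u, rfl⟩))
      simp only [map_zero]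
      have h00 : (0, 0) ∈ degreeLE e := by simp
      rw [Finset.sum_eq_single u] at this
      · rw [Finset.sum_eq_single ⟨(0, 0), h00⟩] at this ⊢
        · simp only [and_self, if_true, Pi.single_eq_same, smul_eq_mul] at this
          rw [(mul_eq_zero.1 this).resolve_right qFact_three_ne_zero, zero_mul, zero_mul]
        · rintro ⟨⟨k, l⟩, hd⟩ - hne
          have : ¬(k = 0 ∧ l = 0) := fun h => hne (by simp [h])
          exact mul_eq_zero_of_right _
            (mul_eq_zero.2 ((not_and_or.1 this).imp zero_pow zero_pow))
        · simp
        · rintro ⟨⟨k, l⟩, hd⟩ - hne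
          have : ¬(k = 0 ∧ l = 0) := fun h => hne (by simp [h])
          simp [this]
        · simp
      · intro w _ hw
        refine Finset.sum_eq_zero fun d _ => ?_
        simp [Pi.single_eq_of_ne hw]
      · simp
    · have hM := h3 z ⟨hz, hp⟩
      have hvec : (fun u => ∑ d : degreeLE e, f (some (u, d)) * qNum 2 ^ (d.1.1 + d.1.2 + 1) *
          (RatFunc.C z ^ d.1.1 * RatFunc.C (starRingEnd ℂ z) ^ d.1.2)) ᵥ* circ z = 0 := by
        ext j
        have hj : ∑ i, (0 : Matrix (Fin 3) (Fin 3) K) i j = 0 := by simp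
        rw [← hM] at hj
        simp only [Matrix.sum_apply, Matrix.smul_apply, rowMatrix_apply, smul_eq_mul, mul_ite,
          mul_zero] at hj
        rw [Finset.sum_comm] at hj
        rw [vecMul, dotProduct, Pi.zero_apply, ← hj]
        refine Finset.sum_congr rfl fun w _ => ?_
        rw [Finset.sum_comm, Finset.sum_mul]
        refine Finset.sum_congr rfl fun d _ => ?_
        simp [mul_assoc]
      exact congrFun (Matrix.eq_zero_of_vecMul_eq_zero (det_circ_ne_zero z) hvec) u
  refine Finset.sum_eq_zero fun u _ => Finset.sum_eq_zero fun d _ => ?_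
  have := congrFun (key u) d
  rw [(mul_eq_zero.1 this).resolve_right (pow_ne_zero _ qNum_two_ne_zero), zero_smul]

/-! ### Orbits under the third roots of unity -/

lemma orbit_eq_of_mem {p q : ℂ × ℂ} (hq : q ∈ orbit p) : orbit q = orbit p := by
  obtain ⟨k, rfl⟩ := hq
  have h3 : ∀ x : ℂ, x ^ 3 = 1 → ∀ j, x ^ (j + 2 * k) * x ^ k = x ^ j := by
    intro x hx j
    rw [← pow_add, show j + 2 * k + k = j + 3 * k by ring, pow_add, pow_mul, hx, one_pow, mul_one]
  ext r
  constructor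
  · rintro ⟨j, rfl⟩
    exact ⟨j + k, by simp only [pow_add, mul_assoc]⟩
  · rintro ⟨j, rfl⟩
    refine ⟨j + 2 * k, ?_⟩
    simp only [← mul_assoc]
    rw [h3 _ ζ_pow_three, h3 _ (by rw [inv_pow, ζ_pow_three, inv_one])]

lemma mem_orbit_self (p : ℂ × ℂ) : p ∈ orbit p := ⟨0, by simp⟩

lemma orbit_eq_iff {p q : ℂ × ℂ} : orbit q = orbit p ↔ q ∈ orbit p :=
  ⟨fun h => h ▸ mem_orbit_self q, orbit_eq_of_mem⟩

lemma inv_ζ : ζ⁻¹ = ζ ^ 2 :=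
  inv_eq_of_mul_eq_one_right (by rw [← pow_succ', ζ_pow_three])

/-- `V_e` is stable under the action of `ℤ/3ℤ`, as all monomials of `p_{m,n}` have the same
triality. -/
lemma mem_vanishingSet_of_mem_orbit {e : ℕ} {p q : ℂ × ℂ} (hp : p ∈ vanishingSet e)
    (hq : q ∈ orbit p) : q ∈ vanishingSet e := by
  obtain ⟨k, rfl⟩ := hq
  intro m n hmn
  have h0 := hp m n hmn
  rw [aeval_koornwinder] at h0 ⊢
  have hmod : ∀ i, ζ ^ i = ζ ^ (i % 3) := fun i => by
    conv_lhs => rw [← Nat.div_add_mod i 3, pow_add, pow_mul, ζ_pow_three, one_pow, one_mul]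
  rw [← mul_zero ((ζ ^ k) ^ (m + 2 * n)), ← h0, Finset.mul_sum]
  refine Finset.sum_congr rfl fun s hs => ?_
  have hs3 : (ζ ^ k) ^ (m + 2 * n) = (ζ ^ k) ^ (s 0 + 2 * s 1) := by
    rw [← pow_mul', ← pow_mul', pow_mul, pow_mul, hmod, ← triality_of_mem_support hs, ← hmod]
  rw [hs3, inv_ζ, mul_smul_comm]
  congr 1
  ring

lemma card_fiber_orbit {p : ℂ × ℂ} (hp : p.1 ≠ 0) :
    ((Finset.range 3).image fun k => (ζ ^ k * p.1, ζ⁻¹ ^ k * p.2)).card = 3 := by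
  rw [Finset.card_image_of_injOn, Finset.card_range]
  intro i hi j hj hij
  simp only [Prod.mk.injEq, mul_left_inj' hp] at hij
  simp only [Finset.coe_range, Set.mem_Iio] at hi hj
  exact isPrimitiveRoot_ζ.pow_inj hi hj hij.1

lemma finite_and_card_nonzeroOrbits (e : ℕ) :
    (nonzeroOrbits e).Finite ∧
      3 * (nonzeroOrbits e).ncard + (if e % 3 = 0 then 1 else 0) = triangular e := by
  classical
  set P := (points e).erase (0, 0)
  have hP : nonzeroOrbits e = ↑(P.image orbit) := by
    rw [nonzeroOrbits, vanishingSet_eq, Finset.coe_image, Finset.coe_erase]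
  have hmem : ∀ q, q ∈ P ↔ q ≠ (0, 0) ∧ q ∈ vanishingSet e := by
    intro q
    rw [Finset.mem_erase, vanishingSet_eq, Finset.mem_coe]
  have hfst : ∀ q ∈ P, q.1 ≠ 0 := by
    intro q hq h0
    obtain ⟨hne, hq⟩ := (hmem q).1 hq
    have h2 := snd_eq_of_mem_vanishingSet hq
    rw [h0, map_zero] at h2
    exact hne (Prod.ext h0 h2)
  have hcard : P.card = 3 * (P.image orbit).card := by
    rw [Finset.card_eq_sum_card_image orbit P, mul_comm, ← smul_eq_mul, ← Finset.sum_const]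
    refine Finset.sum_congr rfl fun b hb => ?_
    obtain ⟨p, hp, rfl⟩ := Finset.mem_image.1 hb
    rw [← card_fiber_orbit (hfst p hp)]
    congr 1
    ext q
    simp only [Finset.mem_filter, Finset.mem_image, Finset.mem_range, orbit_eq_iff]
    constructor
    · rintro ⟨-, k, rfl⟩
      refine ⟨k % 3, Nat.mod_lt _ (by norm_num), ?_⟩
      have hmod : ∀ x : ℂ, x ^ 3 = 1 → x ^ (k % 3) = x ^ k := fun x hx => by
        conv_rhs => rw [← Nat.div_add_mod k 3, pow_add, pow_mul, hx, one_pow, one_mul]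
      rw [hmod _ ζ_pow_three, hmod _ (by rw [inv_pow, ζ_pow_three, inv_one])]
    · rintro ⟨k, -, rfl⟩
      have ho : (ζ ^ k * p.1, ζ⁻¹ ^ k * p.2) ∈ orbit p := ⟨k, rfl⟩
      refine ⟨(hmem _).2 ⟨fun h => ?_, mem_vanishingSet_of_mem_orbit ((hmem p).1 hp).2 ho⟩, ho⟩
      exact mul_ne_zero (pow_ne_zero k ζ_ne_zero) (hfst p hp) (congrArg Prod.fst h)
  rw [hP]
  refine ⟨Finset.finite_toSet _, ?_⟩
  rw [Set.ncard_coe_finset, ← hcard, ← card_degreeLE, ← card_points]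
  have h0 : (0, 0) ∈ points e ↔ e % 3 = 0 := by
    rw [← zero_mem_vanishingSet_iff, vanishingSet_eq, Finset.mem_coe]
  split_ifs with he
  · exact Finset.card_erase_add_one (h0.2 he)
  · rw [add_zero]; exact congrArg _ (Finset.erase_eq_of_notMem fun h => he (h0.1 h))

lemma finite_oneDimLabels (e : ℕ) : (oneDimLabels e).Finite := by
  rw [oneDimLabels]; split_ifs <;> exact Set.toFinite _

lemma ncard_oneDimLabels (e : ℕ) : (oneDimLabels e).ncard = if e % 3 = 0 then 4 else 1 := by
  have hq := qFact_three_ne_zero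
  rw [oneDimLabels]
  split_ifs with he
  · rw [Set.ncard_insert_of_notMem, Set.ncard_insert_of_notMem, Set.ncard_pair]
    · intro h; simpa [hq] using congrFun h 1
    · simp [hq]
    · simp [hq.symm]
  · exact Set.ncard_singleton _

lemma finite_threeDimLabels (e : ℕ) : (threeDimLabels e).Finite := by
  refine ((points e).finite_toSet.image Prod.fst).subset fun z hz => ?_
  rw [← vanishingSet_eq]
  exact ⟨_, hz.2, rfl⟩

/-! ### Modules from representations -/

section Modules

variable {A V W : Type} [Semiring A] [Algebra K A] [AddCommGroup V] [Module K V]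
  [AddCommGroup W] [Module K W]

/-- Elements that act in the same way on a module do so on every isomorphic one. -/
lemma RepModule.eq_of_equiv {φ : A →ₐ[K] Module.End K V} {ψ : A →ₐ[K] Module.End K W}
    (f : RepModule φ ≃ₗ[A] RepModule ψ) {a b : A} (hab : φ a = φ b) : ψ a = ψ b := by
  have hf : ∀ c : A, ∀ y : RepModule ψ, c • y = f (c • f.symm y) := fun c y => by
    rw [map_smul, f.apply_symm_apply]
  have hφ : ∀ x : RepModule φ, a • x = b • x := fun x => LinearMap.congr_fun hab x
  exact LinearMap.ext fun y => (hf a y).trans ((congrArg f (hφ _)).trans (hf b y).symm)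

/-- A linear map that intertwines two representations, as a map of modules. -/
noncomputable def RepModule.hom {φ : A →ₐ[K] Module.End K V} {ψ : A →ₐ[K] Module.End K W} (f : V →ₗ[K] W)
    (hf : ∀ a x, f (φ a x) = ψ a (f x)) : RepModule φ →ₗ[A] RepModule ψ where
  toFun := f
  map_add' := f.map_add
  map_smul' := hf

end Modules

lemma RepModule.isSimpleModule {e : ℕ} {V : Type} [AddCommGroup V] [Module K V] [Nontrivial V]
    (φ : Hecke e →ₐ[K] Module.End K V) (hφ : ∀ x : V, x ≠ 0 → ∀ y, ∃ a, φ a x = y) :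
    IsSimpleModule (Hecke e) (RepModule φ) :=
  isSimpleModule_iff_toSpanSingleton_surjective.2 ⟨inferInstanceAs (Nontrivial V), hφ⟩

/-- If finitely many elements of simple modules have annihilators with zero intersection, then the ring
embeds into a finite sum of these modules; so it is semisimple, and each of its simple
modules, which embeds into the regular module, is isomorphic to one of them. -/
theorem isSemisimpleRing_of_faithful {A ι κ : Type} [Ring A] [Finite ι] [Finite κ] {S : ι → Type}
    {T : κ → Type} [∀ i, AddCommGroup (S i)] [∀ i, Module A (S i)] [∀ j, AddCommGroup (T j)]
    [∀ j, Module A (T j)] (hS : ∀ i, IsSimpleModule A (S i)) (hT : ∀ j, IsSimpleModule A (T j))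
    (x : ∀ i, S i) (y : ∀ j, T j)
    (hxy : ∀ a : A, (∀ i, a • x i = 0) → (∀ j, a • y j = 0) → a = 0) :
    IsSemisimpleRing A ∧ ∀ (N : Type*) [AddCommGroup N] [Module A N], IsSimpleModule A N →
      (∃ i, Nonempty (N ≃ₗ[A] S i)) ∨ (∃ j, Nonempty (N ≃ₗ[A] T j)) := by
  let f : A →ₗ[A] (∀ i, S i) × (∀ j, T j) :=
    (LinearMap.pi fun i => LinearMap.toSpanSingleton A (S i) (x i)).prod
      (LinearMap.pi fun j => LinearMap.toSpanSingleton A (T j) (y j))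
  have hf : Function.Injective f := by
    rw [injective_iff_map_eq_zero]
    intro a ha
    rw [Prod.ext_iff] at ha
    exact hxy a (fun i => congrFun ha.1 i) (fun j => congrFun ha.2 j)
  have hprod : IsSemisimpleModule A ((∀ i, S i) × (∀ j, T j)) :=
    have hsup := IsSemisimpleModule.sup (.range (LinearMap.inl A (∀ i, S i) (∀ j, T j)))
      (.range (LinearMap.inr A (∀ i, S i) (∀ j, T j)))
    .congr (Submodule.topEquiv.symm.trans (LinearEquiv.ofEq _ _ LinearMap.sup_range_inl_inr.symm))
  have hss : IsSemisimpleRing A := IsSemisimpleModule.of_injective f hf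
  refine ⟨hss, fun N _ _ hN => ?_⟩
  obtain ⟨hnt, hsurj⟩ := isSimpleModule_iff_toSpanSingleton_surjective.1 hN
  obtain ⟨n, hn⟩ := exists_ne (0 : N)
  obtain ⟨g, hg⟩ := IsSemisimpleModule.lifting_property (LinearMap.toSpanSingleton A N n) (hsurj n hn)
    LinearMap.id
  have hgn : g n ≠ 0 := by
    intro h
    have := LinearMap.congr_fun hg n
    rw [LinearMap.comp_apply, h, map_zero] at this
    exact hn this.symm
  by_contra! hcon
  refine hgn (hxy _ (fun i => ?_) fun j => ?_)
  · by_contra hi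
    have hne : LinearMap.toSpanSingleton A (S i) (x i) ∘ₗ g ≠ 0 := fun h =>
      hi (LinearMap.congr_fun h n)
    exact (hcon.1 i).false (LinearEquiv.ofBijective _ (LinearMap.bijective_of_ne_zero hne))
  · by_contra hj
    have hne : LinearMap.toSpanSingleton A (T j) (y j) ∘ₗ g ≠ 0 := fun h =>
      hj (LinearMap.congr_fun h n)
    exact (hcon.2 j).false (LinearEquiv.ofBijective _ (LinearMap.bijective_of_ne_zero hne))

/-! ### Simplicity and isomorphisms -/

/-- The character with label `l`, acting on `ℂ(v)`. -/
noncomputable def charRep {e : ℕ} (l : oneDimLabels e) : Hecke e →ₐ[K] Module.End K K :=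
  (Algebra.lmul K K).comp (charLevel (isCharLabel_of_mem l.2))

lemma charRep_apply {e : ℕ} (l : oneDimLabels e) (a : Hecke e) (x : K) :
    charRep l a x = charLevel (isCharLabel_of_mem l.2) a * x := rfl

lemma charRep_eq_iff {e : ℕ} (l : oneDimLabels e) (a b : Hecke e) :
    charRep l a = charRep l b ↔
      charLevel (isCharLabel_of_mem l.2) a = charLevel (isCharLabel_of_mem l.2) b := by
  constructor
  · intro h
    simpa [charRep_apply] using LinearMap.congr_fun h (1 : K)
  · intro h
    ext
    simp [charRep_apply, h]

lemma isSimpleModule_charRep {e : ℕ} (l : oneDimLabels e) :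
    IsSimpleModule (Hecke e) (RepModule (charRep l)) := by
  refine RepModule.isSimpleModule _ fun x hx y => ⟨algebraMap K _ (y / x), ?_⟩
  rw [charRep_apply, AlgHom.commutes]
  exact div_mul_cancel₀ y hx

lemma eq_of_charRep_equiv {e : ℕ} {l l' : oneDimLabels e}
    (f : RepModule (charRep l) ≃ₗ[Hecke e] RepModule (charRep l')) : l = l' := by
  ext u
  have h : charRep l (θ e u) = charRep l (algebraMap K _ (l.1 u)) := by
    rw [charRep_eq_iff, charLevel_θ, AlgHom.commutes]; rfl
  have h' := RepModule.eq_of_equiv f h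
  rw [charRep_eq_iff, charLevel_θ, AlgHom.commutes] at h'
  exact h'.symm

/-- The three-dimensional representation `M_z`, acting on column vectors. -/
noncomputable def matRep {e : ℕ} (z : threeDimLabels e) :
    Hecke e →ₐ[K] Module.End K (Fin 3 → K) :=
  (Matrix.toLinAlgEquiv' : Matrix (Fin 3) (Fin 3) K ≃ₐ[K] _).toAlgHom.comp (repLevel z.2.2)

lemma matRep_apply {e : ℕ} (z : threeDimLabels e) (a : Hecke e) (x : Fin 3 → K) :
    matRep z a x = repLevel z.2.2 a *ᵥ x := rfl

lemma matRep_eq_iff {e : ℕ} (z : threeDimLabels e) (a b : Hecke e) :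
    matRep z a = matRep z b ↔ repLevel z.2.2 a = repLevel z.2.2 b :=
  (Matrix.toLinAlgEquiv' : Matrix (Fin 3) (Fin 3) K ≃ₐ[K] _).injective.eq_iff

lemma C_ne_zero {z : ℂ} (hz : z ≠ 0) : RatFunc.C z ≠ 0 :=
  (map_ne_zero RatFunc.C).2 hz

lemma isSimpleModule_matRep {e : ℕ} (z : threeDimLabels e) :
    IsSimpleModule (Hecke e) (RepModule (matRep z)) := by
  refine RepModule.isSimpleModule _ fun x hx y => ?_
  -- Some `θ_u` does not kill `x`, and the `h^{k,0}_u` then map `x` to multiples of the basis vectors.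
  obtain ⟨u, hu⟩ : ∃ u, (circ z.1 *ᵥ x) u ≠ 0 := by
    by_contra! h
    exact hx (Matrix.eq_zero_of_mulVec_eq_zero (det_circ_ne_zero z.1) (funext h))
  have hk : ∀ u w : Fin 3, ∃ k : Fin 3, u + k.1 • (1 : Fin 3) - 0 • (1 : Fin 3) = w := by decide
  choose k hk using hk u
  have hh : ∀ w, ∃ b : K, b ≠ 0 ∧ repLevel z.2.2 (RingQuot.mkAlgHom K (RelLevel e) (h u (k w) 0)) *ᵥ x =
      b • Pi.single w 1 := by
    intro w
    refine ⟨qNum 2 ^ ((k w).1 + 0 + 1) *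
      (RatFunc.C z.1 ^ (k w).1 * RatFunc.C (starRingEnd ℂ z.1) ^ 0) * (circ z.1 *ᵥ x) u, ?_, ?_⟩
    · refine mul_ne_zero (mul_ne_zero (pow_ne_zero _ qNum_two_ne_zero) (mul_ne_zero
        (pow_ne_zero _ (C_ne_zero z.2.1)) (by simp))) hu
    · rw [repLevel_h, color, hk, Matrix.smul_mulVec, rowMatrix, Matrix.vecMulVec_mulVec, mul_smul]
      rw [← mul_smul]
      ext i
      simp only [Matrix.mulVec, Pi.smul_apply, MulOpposite.smul_eq_mul_unop, MulOpposite.unop_op,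
        smul_eq_mul]
      ring
  choose b hb hbw using hh
  refine ⟨∑ w, (y w / b w) • RingQuot.mkAlgHom K (RelLevel e) (h u (k w) 0), ?_⟩
  rw [map_sum, LinearMap.sum_apply]
  conv_rhs => rw [pi_eq_sum_univ' y]
  refine Finset.sum_congr rfl fun w _ => ?_
  rw [map_smul, LinearMap.smul_apply, matRep_apply, hbw, smul_smul, div_mul_cancel₀ _ (hb w)]

lemma isEmpty_charRep_equiv_matRep {e : ℕ} (l : oneDimLabels e) (z : threeDimLabels e) :
    IsEmpty (RepModule (charRep l) ≃ₗ[Hecke e] RepModule (matRep z)) := by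
  refine ⟨fun f => ?_⟩
  have h : charRep l (θ e 0) = charRep l (algebraMap K _ (l.1 0)) := by
    rw [charRep_eq_iff, charLevel_θ, AlgHom.commutes]; rfl
  have h' := RepModule.eq_of_equiv f h
  rw [matRep_eq_iff, repLevel_θ, AlgHom.commutes] at h'
  have h00 := congrFun (congrFun h' 0) 0
  have h11 := congrFun (congrFun h' 1) 1
  simp [repMatrix, Matrix.algebraMap_matrix_apply] at h00 h11
  rw [← h11] at h00
  exact mul_ne_zero qNum_two_ne_zero qNum_three_ne_zero h00

lemma mem_orbit_of_pow_three_eq {z z' : ℂ} (hz : z ≠ 0) (h : z' ^ 3 = z ^ 3) :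
    (z', starRingEnd ℂ z') ∈ orbit (z, starRingEnd ℂ z) := by
  obtain ⟨k, -, hk⟩ := isPrimitiveRoot_ζ.eq_pow_of_pow_eq_one (ξ := z' / z)
    (by rw [div_pow, h, div_self (pow_ne_zero 3 hz)])
  rw [eq_div_iff hz] at hk
  refine ⟨k, ?_⟩
  rw [← hk, map_mul, map_pow, conj_ζ]

/-- The isomorphism class of `M_z` determines `z³`, since `θ_g θ_p θ_o θ_g` acts on `M_z` as
`[2]³ z³ θ_g`. -/
lemma orbit_eq_of_matRep_equiv {e : ℕ} {z z' : threeDimLabels e}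
    (f : RepModule (matRep z) ≃ₗ[Hecke e] RepModule (matRep z')) :
    orbit (z.1, starRingEnd ℂ z.1) = orbit (z'.1, starRingEnd ℂ z'.1) := by
  have hc : color 0 3 0 = 0 ∧ color 0 0 0 = 0 := by decide
  have hrep : ∀ w : threeDimLabels e,
      repLevel w.2.2 (RingQuot.mkAlgHom K (RelLevel e) (h 0 3 0)) =
        (qNum 2 ^ 4 * RatFunc.C w.1 ^ 3) • rowMatrix w.1 0 0 ∧
      repLevel w.2.2 (RingQuot.mkAlgHom K (RelLevel e) ((qNum 2 ^ 3 * RatFunc.C z.1 ^ 3) • h 0 0 0)) =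
        (qNum 2 ^ 4 * RatFunc.C z.1 ^ 3) • rowMatrix w.1 0 0 := by
    intro w
    rw [map_smul, map_smul, repLevel_h, repLevel_h, hc.1, hc.2, smul_smul]
    constructor <;> congr 1 <;> ring
  have h0 := RepModule.eq_of_equiv f ((matRep_eq_iff z _ _).2 ((hrep z).1.trans (hrep z).2.symm))
  rw [matRep_eq_iff, (hrep z').1, (hrep z').2] at h0
  have h1 := congrFun (congrFun h0 0) 0
  rw [Matrix.smul_apply, Matrix.smul_apply, rowMatrix_apply, if_pos rfl, circ_diag, smul_eq_mul,
    smul_eq_mul] at h1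
  have h2 := mul_left_cancel₀ (pow_ne_zero 4 qNum_two_ne_zero)
    (mul_right_cancel₀ qNum_three_ne_zero h1)
  rw [← map_pow, ← map_pow] at h2
  exact (orbit_eq_of_mem (mem_orbit_of_pow_three_eq z.2.1 (RatFunc.C.injective h2))).symm

/-- A diagonal matrix intertwines `M_z` and `M_{ζ^k z}`. -/
lemma nonempty_matRep_equiv {e : ℕ} {z z' : threeDimLabels e}
    (ho : orbit (z.1, starRingEnd ℂ z.1) = orbit (z'.1, starRingEnd ℂ z'.1)) :
    Nonempty (RepModule (matRep z) ≃ₗ[Hecke e] RepModule (matRep z')) := by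
  obtain ⟨k, hk⟩ := orbit_eq_iff.1 ho.symm
  rw [Prod.mk.injEq, inv_ζ] at hk
  set w : K := RatFunc.C (ζ ^ k)
  have hw : w ^ 3 = 1 := by
    rw [← map_pow, ← pow_mul, mul_comm, pow_mul, ζ_pow_three, one_pow, map_one]
  have hz : RatFunc.C z'.1 = w * RatFunc.C z.1 := by rw [hk.1, map_mul]
  have hz' : RatFunc.C (starRingEnd ℂ z'.1) = w ^ 2 * RatFunc.C (starRingEnd ℂ z.1) := by
    rw [hk.2, map_mul, ← map_pow, ← pow_mul, ← pow_mul, mul_comm k]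
  set d : Fin 3 → K := ![1, w, w ^ 2]
  have hcirc : ∀ u j, d u * circ z.1 u j = circ z'.1 u j * d j := by
    intro u j
    fin_cases u <;> fin_cases j <;> simp [circ, hz, hz', d] <;> ring_nf
    · rw [hw, one_mul]
    · rw [hw, one_mul]
    · linear_combination (-w * RatFunc.C (starRingEnd ℂ z.1)) * hw
  have hcomm : ∀ a, Matrix.diagonal d * repLevel z.2.2 a = repLevel z'.2.2 a * Matrix.diagonal d := by
    intro a
    induction a using hecke_induction with
    | hK r => rw [AlgHom.commutes, AlgHom.commutes]; exact (Algebra.commutes r _).symm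
    | hθ u =>
      rw [repLevel_θ, repLevel_θ, repMatrix_eq, repMatrix_eq, mul_smul_comm, smul_mul_assoc]
      congr 1
      ext i j
      rw [Matrix.diagonal_mul, Matrix.mul_diagonal, rowMatrix_apply, rowMatrix_apply]
      split_ifs with hi
      · rw [hi, hcirc]
      · rw [mul_zero, zero_mul]
    | hmul a b ha hb => rw [map_mul, map_mul, ← mul_assoc, ha, mul_assoc, hb, mul_assoc]
    | hadd a b ha hb => rw [map_add, map_add, mul_add, ha, hb, add_mul]
  obtain ⟨f, hf⟩ : ∃ f : RepModule (matRep z) →ₗ[Hecke e] RepModule (matRep z'), f ≠ 0 := by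
    refine ⟨RepModule.hom (Matrix.toLin' (Matrix.diagonal d)) fun a x => ?_, fun hf0 => ?_⟩
    · rw [matRep_apply, matRep_apply, Matrix.toLin'_apply, Matrix.toLin'_apply, mulVec_mulVec,
        mulVec_mulVec, hcomm]
    · have h1 : Matrix.diagonal d *ᵥ Pi.single 0 1 = 0 := LinearMap.congr_fun hf0 (Pi.single 0 1)
      simpa [d] using congrFun h1 0
  have := isSimpleModule_matRep z
  have := isSimpleModule_matRep z'
  exact ⟨LinearEquiv.ofBijective f (LinearMap.bijective_of_ne_zero (R := Hecke e) hf)⟩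

end Trihedral

theorem theorem2p19 (e : ℕ) :
    -- the algebra is semisimple
    IsSemisimpleRing (Trihedral.Hecke e) ∧
    -- all common zeros are of the form `(z, z̄)`, and `(0, 0)` is one of them iff `e ≡ 0 mod 3`
    (∀ p ∈ Trihedral.vanishingSet e, p.2 = starRingEnd ℂ p.1) ∧
    ((0, 0) ∈ Trihedral.vanishingSet e ↔ e % 3 = 0) ∧
    -- the number of labels: one-dimensional and three-dimensional
    (Trihedral.oneDimLabels e).ncard = (if e % 3 = 0 then 4 else 1) ∧
    (Trihedral.nonzeroOrbits e).Finite ∧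
    3 * (Trihedral.nonzeroOrbits e).ncard + (if e % 3 = 0 then 1 else 0) =
      Trihedral.triangular e ∧
    -- the representations with these labels exist
    ∃ (χ : Trihedral.oneDimLabels e →
          (Trihedral.Hecke e →ₐ[Trihedral.K] Module.End Trihedral.K Trihedral.K))
      (M : Trihedral.threeDimLabels e →
          (Trihedral.Hecke e →ₐ[Trihedral.K] Module.End Trihedral.K (Fin 3 → Trihedral.K))),
      (∀ (l : Trihedral.oneDimLabels e) (u : Fin 3),
        χ l (Trihedral.θ e u) = l.1 u • LinearMap.id) ∧
      (∀ (z : Trihedral.threeDimLabels e) (u : Fin 3),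
        M z (Trihedral.θ e u) = Matrix.toLin' (Trihedral.repMatrix z.1 u)) ∧
      -- they are simple
      (∀ l, IsSimpleModule (Trihedral.Hecke e) (Trihedral.RepModule (χ l))) ∧
      (∀ z, IsSimpleModule (Trihedral.Hecke e) (Trihedral.RepModule (M z))) ∧
      -- the only isomorphisms are between `M_z` and `M_z'` for labels in the same orbit
      (∀ l l', Nonempty (Trihedral.RepModule (χ l) ≃ₗ[Trihedral.Hecke e]
        Trihedral.RepModule (χ l')) → l = l') ∧
      (∀ z z', Nonempty (Trihedral.RepModule (M z) ≃ₗ[Trihedral.Hecke e]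
        Trihedral.RepModule (M z')) ↔
          Trihedral.orbit (z.1, starRingEnd ℂ z.1) = Trihedral.orbit (z'.1, starRingEnd ℂ z'.1)) ∧
      (∀ l z, IsEmpty (Trihedral.RepModule (χ l) ≃ₗ[Trihedral.Hecke e]
        Trihedral.RepModule (M z))) ∧
      -- every simple module is isomorphic to one of them
      ∀ (S : Type*) [AddCommGroup S] [Module (Trihedral.Hecke e) S],
        IsSimpleModule (Trihedral.Hecke e) S →
          (∃ l, Nonempty (S ≃ₗ[Trihedral.Hecke e] Trihedral.RepModule (χ l))) ∨
          (∃ z, Nonempty (S ≃ₗ[Trihedral.Hecke e] Trihedral.RepModule (M z))) := by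
  have hfin1 := (Trihedral.finite_oneDimLabels e).to_subtype
  have hfin3 := (Trihedral.finite_threeDimLabels e).to_subtype
  obtain ⟨hss, hsimple⟩ := Trihedral.isSemisimpleRing_of_faithful
    (A := Trihedral.Hecke e) (S := fun l => Trihedral.RepModule (Trihedral.charRep l))
    (T := fun j : Trihedral.threeDimLabels e × Fin 3 => Trihedral.RepModule (Trihedral.matRep j.1))
    Trihedral.isSimpleModule_charRep (fun j => Trihedral.isSimpleModule_matRep j.1)
    (fun _ => (1 : Trihedral.K)) (fun j => (Pi.single j.2 1 : Fin 3 → Trihedral.K))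
    (fun a h1 h3 => by
      refine Trihedral.eq_zero_of_reps a (fun l hl => ?_) fun z hz => ?_
      · have h : Trihedral.charLevel (Trihedral.isCharLabel_of_mem hl) a * 1 = 0 := h1 ⟨l, hl⟩
        rwa [mul_one] at h
      · ext i j
        have h : Matrix.mulVec (Trihedral.repLevel hz.2 a) (Pi.single j 1) = 0 := h3 (⟨z, hz⟩, j)
        rw [Matrix.mulVec_single_one] at h
        exact congrFun h i)
  obtain ⟨hofin, hocard⟩ := Trihedral.finite_and_card_nonzeroOrbits e
  refine ⟨hss, fun p hp => Trihedral.snd_eq_of_mem_vanishingSet hp,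
    Trihedral.zero_mem_vanishingSet_iff e, Trihedral.ncard_oneDimLabels e, hofin, hocard,
    Trihedral.charRep, Trihedral.matRep, fun l u => ?_, fun z u => ?_,
    Trihedral.isSimpleModule_charRep, Trihedral.isSimpleModule_matRep,
    fun l l' ⟨f⟩ => Trihedral.eq_of_charRep_equiv f,
    fun z z' => ⟨fun ⟨f⟩ => Trihedral.orbit_eq_of_matRep_equiv f,
      Trihedral.nonempty_matRep_equiv⟩,
    Trihedral.isEmpty_charRep_equiv_matRep, fun S _ _ hS => ?_⟩
  · ext
    rw [Trihedral.charRep_apply, Trihedral.charLevel_θ]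
    simp
  · ext x : 1
    rw [Trihedral.matRep, AlgHom.comp_apply, Trihedral.repLevel_θ]
    rfl
  · exact (hsimple S hS).imp_right fun ⟨j, hj⟩ => ⟨j.1, hj⟩
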